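/- **Proposition 2.5.** Consider the linear Gaussian factor model with coefficients $r\ge 0$, $a\in\mathbb R^m$, $b\in\mathbb R^n$, $A\in\mathbb R^{m\times n}$, $B\in\mathbb R^{n\times n}$, $\Sigma\in\mathbb R^{m\times(n+m)}$, $\Lambda\in\mathbb R^{n\times(n+m)}$, and write $^*$ for transpose and $\mathbf 1=(1,\dots,1)^*$. Assume - (A1) $\Sigma\Sigma^*>0$; - (A2) $G:=B-\Lambda\Sigma^*(\Sigma\Sigma^*)^{-1}A$ is stable, i.e. all its (complex) eigenvalues have negative real part. For $\gamma<0$ put $$N^{-1}:=I+\tfrac{\gamma}{1-\gamma}\Sigma^*(\Sigma\Sigma^*)^{-1}\Sigma,\quad K_1:=B+\tfrac{\gamma}{1-\gamma}\Lambda\Sigma^*(\Sigma\Sigma^*)^{-1}A,\quad C:=\sqrt{-\tfrac{\gamma}{1-\gamma}}\;\Sigma^*(\Sigma\Sigma^*)^{-1}A,$$ and for $T>0$ let $P(t)=P(t;T;\gamma)$ and $q(t)=q(t;T;\gamma)$, $0\le t\le T$, solve $$\dot P+K_1^*P+PK_1+P\Lambda N^{-1}\Lambda^*P-C^*C=0,\qquad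 P(T)=0,$$ $$\dot q+(K_1+\Lambda N^{-1}\Lambda^*P)^*q+Pb+\tfrac{\gamma}{1-\gamma}(A^*+P\Lambda\Sigma^*)(\Sigma\Sigma^*)^{-1}(a-r\mathbf 1)=0,\qquad q(T)=0.$$ By the stationary Riccati data at $\gamma$ we mean a symmetric matrix $\bar P(\gamma)\in\mathbb R^{n\times n}$ and a vector $\bar q(\gamma)\in\mathbb R^n$ with $$K_1^*\bar P+\bar PK_1+\bar P\Lambda N^{-1}\Lambda^*\bar P-C^*C=0,$$ $$(K_1+\Lambda N^{-1}\Lambda^*\bar P)^*\bar q+\bar Pb+\tfrac{\gamma}{1-\gamma}(A^*+\bar P\Lambda\Sigma^*)(\Sigma\Sigma^*)^{-1}(a-r\mathbf 1)=0,$$ such that $P(t;T;\gamma)\to\bar P(\gamma)$ and $q(t;T;\gamma)\to\bar q(\gamma)$ as $T\to\infty$, for every $t\ge 0$. The ergodic constant is $$\chi(\gamma):=\tfrac12\operatorname{tr}(\Lambda\Lambda^*\bar P)+\tfrac12\bar q^*\Lambda\Lambda^*\bar q+b^*\bar q+\gamma r+\tfrac{\gamma}{2(1-\gamma)}(a-r\mathbf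 1+\Sigma\Lambda^*\bar q)^*(\Sigma\Sigma^*)^{-1}(a-r\mathbf 1+\Sigma\Lambda^*\bar q),$$ where $\bar P=\bar P(\gamma)$ and $\bar q=\bar q(\gamma)$. Then for every $\gamma<0$ the stationary Riccati data exist (together with the solutions $P,q$ for all $T>0$) and are unique, and - (i) $\chi(\gamma)$, $\bar P(\gamma)$ and $\bar q(\gamma)$ are twice differentiable with respect to $\gamma\in(-\infty,0)$; - (ii) $\chi$ is convex on $(-\infty,0)$. -/

import Mathlib

open Set Filter Topology
open scoped Matrix

noncomputable section

/-- Coefficients of the linear Gaussian factor model with `m` risky stocks and `n` factors: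
interest rate `r ≥ 0`, stock drift `a + A y`, stock volatility `vol`,
factor drift `b + B y`, factor volatility `lam`, all driven by an
`(n + m)`-dimensional Brownian motion. -/
structure FactorModel (m n : ℕ) where
  r : ℝ
  r_nonneg : 0 ≤ r
  a : Fin m → ℝ
  b : Fin n → ℝ
  A : Matrix (Fin m) (Fin n) ℝ
  B : Matrix (Fin n) (Fin n) ℝ
  vol : Matrix (Fin m) (Fin (n + m)) ℝ
  lam : Matrix (Fin n) (Fin (n + m)) ℝ

/-- A real square matrix is stable if all its complex eigenvalues have negative real part. -/
def IsStableMatrix {n : ℕ} (G : Matrix (Fin n) (Fin n) ℝ) : Prop :=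
  ∀ z ∈ spectrum ℂ (G.map (fun x : ℝ => (x : ℂ))), z.re < 0

/-- `f` is twice differentiable on the half-line `γ < 0`. -/
def TwiceDifferentiableOnNeg {E : Type*} [NormedAddCommGroup E] [NormedSpace ℝ E]
    (f : ℝ → E) : Prop :=
  ∀ γ : ℝ, γ < 0 → DifferentiableAt ℝ f γ ∧ DifferentiableAt ℝ (deriv f) γ

namespace FactorModel

variable {m n : ℕ} (M : FactorModel m n)

/-- The inverse covariance matrix of the stocks, `(Σ Σ*)⁻¹`. -/
def covInv : Matrix (Fin m) (Fin m) ℝ := (M.vol * M.volᵀ)⁻¹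

/-- Assumption (A1): `Σ Σ* > 0`. -/
def A1 : Prop := (M.vol * M.volᵀ).PosDef

/-- Assumption (A2): `G = B - Λ Σ* (Σ Σ*)⁻¹ A` is stable. -/
def A2 : Prop := IsStableMatrix (M.B - M.lam * M.volᵀ * M.covInv * M.A)

/-- The excess return vector at the origin, `a - r 𝟏`. -/
def excess : Fin m → ℝ := fun i => M.a i - M.r

/-- `N⁻¹ = I + γ / (1 - γ) Σ* (Σ Σ*)⁻¹ Σ`. -/
def NInv (γ : ℝ) : Matrix (Fin (n + m)) (Fin (n + m)) ℝ :=
  1 + (γ / (1 - γ)) • (M.volᵀ * M.covInv * M.vol)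

/-- `K₁ = B + γ / (1 - γ) Λ Σ* (Σ Σ*)⁻¹ A`. -/
def K1 (γ : ℝ) : Matrix (Fin n) (Fin n) ℝ :=
  M.B + (γ / (1 - γ)) • (M.lam * M.volᵀ * M.covInv * M.A)

/-- `C = √(-γ / (1 - γ)) Σ* (Σ Σ*)⁻¹ A`. -/
def C (γ : ℝ) : Matrix (Fin (n + m)) (Fin n) ℝ :=
  Real.sqrt (-(γ / (1 - γ))) • (M.volᵀ * M.covInv * M.A)

/-- `K₁* X + X K₁ + X Λ N⁻¹ Λ* X - C* C`. -/
def riccatiOp (γ : ℝ) (X : Matrix (Fin n) (Fin n) ℝ) : Matrix (Fin n) (Fin n) ℝ :=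
  (M.K1 γ)ᵀ * X + X * M.K1 γ + X * M.lam * M.NInv γ * M.lamᵀ * X - (M.C γ)ᵀ * M.C γ

/-- `(K₁ + Λ N⁻¹ Λ* X)* x + X b + γ / (1 - γ) (A* + X Λ Σ*) (Σ Σ*)⁻¹ (a - r 𝟏)`. -/
def linearOp (γ : ℝ) (X : Matrix (Fin n) (Fin n) ℝ) (x : Fin n → ℝ) : Fin n → ℝ :=
  (M.K1 γ + M.lam * M.NInv γ * M.lamᵀ * X)ᵀ *ᵥ x + X *ᵥ M.b
    + (γ / (1 - γ)) • (((M.Aᵀ + X * M.lam * M.volᵀ) * M.covInv) *ᵥ M.excess)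

/-- `P` solves, on `[0, T]`, the matrix Riccati differential equation
`P' + K₁* P + P K₁ + P Λ N⁻¹ Λ* P - C* C = 0`, `P(T) = 0`
(derivatives are taken entrywise, one-sided at the end points). -/
def SolvesRiccatiODE (γ T : ℝ) (P : ℝ → Matrix (Fin n) (Fin n) ℝ) : Prop :=
  (∀ t ∈ Icc 0 T, ∀ i j,
    HasDerivWithinAt (fun s => P s i j) (-(M.riccatiOp γ (P t) i j)) (Icc 0 T) t) ∧ P T = 0

/-- `q` solves, on `[0, T]`, the linear differential equation
`q' + (K₁ + Λ N⁻¹ Λ* P)* q + P b + γ / (1 - γ) (A* + P Λ Σ*) (Σ Σ*)⁻¹ (a - r 𝟏) = 0`, `q(T) = 0`. -/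
def SolvesLinearODE (γ T : ℝ) (P : ℝ → Matrix (Fin n) (Fin n) ℝ) (q : ℝ → Fin n → ℝ) : Prop :=
  (∀ t ∈ Icc 0 T, HasDerivWithinAt q (-(M.linearOp γ (P t) (q t))) (Icc 0 T) t) ∧ q T = 0

/-- `(X, x)` is the pair of stationary Riccati data at `γ`: a solution of the stationary equations
that is the long-horizon limit of the finite-horizon solutions `P T t = P(t; T)`,
`q T t = q(t; T)`. -/
structure IsStationaryData (γ : ℝ) (X : Matrix (Fin n) (Fin n) ℝ) (x : Fin n → ℝ) : Prop where
  symm : X.IsSymm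
  riccati : M.riccatiOp γ X = 0
  linear : M.linearOp γ X x = 0
  limit : ∃ (P : ℝ → ℝ → Matrix (Fin n) (Fin n) ℝ) (q : ℝ → ℝ → Fin n → ℝ),
    (∀ T, 0 < T → M.SolvesRiccatiODE γ T (P T) ∧ M.SolvesLinearODE γ T (P T) (q T)) ∧
    ∀ t, 0 ≤ t → Tendsto (fun T => P T t) atTop (𝓝 X) ∧ Tendsto (fun T => q T t) atTop (𝓝 x)

/-- The ergodic constant attached to stationary data `(X, x)`. -/
def ergodicConstant (γ : ℝ) (X : Matrix (Fin n) (Fin n) ℝ) (x : Fin n → ℝ) : ℝ :=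
  1 / 2 * (M.lam * M.lamᵀ * X).trace + 1 / 2 * (x ⬝ᵥ (M.lam * M.lamᵀ) *ᵥ x) + M.b ⬝ᵥ x + γ * M.r
    + γ / (2 * (1 - γ)) *
      ((M.excess + (M.vol * M.lamᵀ) *ᵥ x) ⬝ᵥ M.covInv *ᵥ (M.excess + (M.vol * M.lamᵀ) *ᵥ x))

end FactorModel

end

/-! Write `τ = γ / (1 - γ)`, which lies in (-1, 0), `R = Λ N⁻¹ Λ*`, `W = C* C`, and `Q = -P`. In
reversed time `Q` solves the Riccati equation `Q' = K₁ᵀ Q + Q K₁ - Q R Q + W`, `Q(0) = 0`, of a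
linear-quadratic regulator with `R ≥ 0` and `W ≥ 0`. Put `D = Σ* (Σ Σ*)⁻¹ A`. Then `K₁ - G = (1 + τ)
Λ D` and `W = -τ Dᵀ D`, so stability of `G` supplies both stabilizability and detectability.

Existence. The Hamiltonian linear system gives a global solution `Q = Y X⁻¹`. It is increasing, and
bounded by stabilizability (`riccatiFlow_bounded`), so it converges to a stationary solution.
Detectability makes the limiting closed loop `F = K₁ + R P̄` stable (`lyapunovStable_closedLoop`),
which forces the linear flow for `q` to converge as well (`tendsto_affineFlow`). Uniqueness of the
data is uniqueness for the terminal value problems followed by uniqueness of limits.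

Smoothness. The linearisation of the Riccati operator at `P̄` is `H ↦ Fᵀ H + H F`, which is
injective because `F` is stable (`eq_zero_of_sylvester`). The implicit function theorem gives a `C²`
branch, and a second Sylvester argument identifies it with `P̄`. The vector `q̄` then comes from
inverting `Fᵀ`, and `χ` is an explicit expression in both.

Convexity. The function `w(x) = ½ x·P̄x + q̄·x` solves the ergodic Bellman equation (`A1.bellman`),
whose Hamiltonian is jointly convex in `γ` and the gradient (`A1.bellmanHam_gradient`). Linearising
at `γ₀ = s₁ γ₁ + s₂ γ₂` and averaging gives an inequality in which the generator of the stable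
closed-loop diffusion at `γ₀` acts on a quadratic function and is bounded above by `s₁ χ₁ + s₂ χ₂ -
χ₀`. Integrating against the invariant law would give convexity; `LyapunovStable.trace_nonneg_of_le`
does this algebraically, by evaluating at the equilibrium and showing that the diffusion term is
nonnegative. -/

noncomputable section

/-! ### Dot-product estimates and derivatives of matrix-valued functions. -/

namespace Matrix

variable {ι κ : Type*} [Fintype ι] [Fintype κ]

theorem mulVec_dotProduct_eq (A : Matrix κ ι ℝ) (x : ι → ℝ) (y : κ → ℝ) :
    (A *ᵥ x) ⬝ᵥ y = x ⬝ᵥ (Aᵀ *ᵥ y) := by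
  rw [Matrix.mulVec_transpose, dotProduct_comm, Matrix.dotProduct_mulVec, dotProduct_comm]

theorem dotProduct_mulVec_eq (A : Matrix κ ι ℝ) (x : ι → ℝ) (y : κ → ℝ) :
    y ⬝ᵥ (A *ᵥ x) = (Aᵀ *ᵥ y) ⬝ᵥ x := by
  rw [dotProduct_comm, mulVec_dotProduct_eq, dotProduct_comm]

theorem dotProduct_self_nonneg (x : ι → ℝ) : 0 ≤ x ⬝ᵥ x :=
  Finset.sum_nonneg fun i _ => mul_self_nonneg (x i)

theorem dotProduct_self_pos {x : ι → ℝ} (hx : x ≠ 0) : 0 < x ⬝ᵥ x :=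
  lt_of_le_of_ne (dotProduct_self_nonneg x) fun h => hx (dotProduct_self_eq_zero.mp h.symm)

theorem sq_le_dotProduct_self (x : ι → ℝ) (i : ι) : x i ^ 2 ≤ x ⬝ᵥ x := by
  rw [sq]
  exact Finset.single_le_sum (f := fun i => x i * x i) (fun j _ => mul_self_nonneg (x j))
    (Finset.mem_univ i)

/-- Young's inequality for the dot product. -/
theorem two_mul_dotProduct_le {ε : ℝ} (hε : 0 < ε) (x y : ι → ℝ) :
    2 * (x ⬝ᵥ y) ≤ ε * (x ⬝ᵥ x) + ε⁻¹ * (y ⬝ᵥ y) := by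
  have h := dotProduct_self_nonneg (ε • x - y)
  simp only [sub_dotProduct, dotProduct_sub, smul_dotProduct, dotProduct_smul, smul_eq_mul,
    dotProduct_comm y x] at h
  have h2 : 0 ≤ ε⁻¹ * (ε * (ε * x ⬝ᵥ x - x ⬝ᵥ y) - (ε * x ⬝ᵥ y - y ⬝ᵥ y)) :=
    mul_nonneg (inv_nonneg.mpr hε.le) h
  have h3 : ε⁻¹ * (ε * (ε * x ⬝ᵥ x - x ⬝ᵥ y) - (ε * x ⬝ᵥ y - y ⬝ᵥ y)) =
      ε * (x ⬝ᵥ x) - 2 * (x ⬝ᵥ y) + ε⁻¹ * (y ⬝ᵥ y) := by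
    field_simp
    ring
  linarith

theorem exists_mulVec_dotProduct_self_le (A : Matrix κ ι ℝ) :
    ∃ c : ℝ, 0 < c ∧ ∀ x, (A *ᵥ x) ⬝ᵥ (A *ᵥ x) ≤ c * (x ⬝ᵥ x) := by
  refine ⟨∑ i, ∑ j, A i j ^ 2 + 1, by positivity, fun x => ?_⟩
  have h : (A *ᵥ x) ⬝ᵥ (A *ᵥ x) ≤ (∑ i, ∑ j, A i j ^ 2) * (x ⬝ᵥ x) := by
    rw [Finset.sum_mul]
    refine Finset.sum_le_sum fun i _ => ?_
    have := Finset.sum_mul_sq_le_sq_mul_sq Finset.univ (A i) x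
    simpa [mulVec, dotProduct, sq] using this
  linarith [dotProduct_self_nonneg x]

theorem exists_abs_dotProduct_mulVec_le (A : Matrix ι ι ℝ) :
    ∃ c : ℝ, 0 < c ∧ ∀ x, |x ⬝ᵥ (A *ᵥ x)| ≤ c * (x ⬝ᵥ x) := by
  obtain ⟨c, hc, h⟩ := exists_mulVec_dotProduct_self_le A
  refine ⟨1 + c, by positivity, fun x => ?_⟩
  have h1 := two_mul_dotProduct_le one_pos x (A *ᵥ x)
  have h2 := two_mul_dotProduct_le one_pos (-x) (A *ᵥ x)
  simp only [neg_dotProduct, dotProduct_neg, neg_neg] at h2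
  have := h x
  have := dotProduct_self_nonneg x
  have := mul_nonneg hc.le this
  rw [abs_le]
  constructor <;> linarith

theorem dotProduct_mulVec_comm {A : Matrix ι ι ℝ} (hA : A.IsSymm) (x y : ι → ℝ) :
    x ⬝ᵥ (A *ᵥ y) = y ⬝ᵥ (A *ᵥ x) := by
  rw [dotProduct_mulVec_eq, hA.eq, dotProduct_comm]

/-- Matrices with the same bilinear form are equal. -/
theorem ext_dotProduct_mulVec [DecidableEq ι] {A B : Matrix ι ι ℝ}
    (h : ∀ x y, x ⬝ᵥ (A *ᵥ y) = x ⬝ᵥ (B *ᵥ y)) : A = B := by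
  ext i j
  simpa using h (Pi.single i 1) (Pi.single j 1)

/-- The entries of a symmetric matrix by polarisation. -/
theorem IsSymm.apply_eq [DecidableEq ι] {A : Matrix ι ι ℝ} (hA : A.IsSymm) (i j : ι) :
    A i j = ((Pi.single i 1 + Pi.single j 1) ⬝ᵥ (A *ᵥ (Pi.single i 1 + Pi.single j 1))
      - Pi.single i 1 ⬝ᵥ (A *ᵥ Pi.single i 1) - Pi.single j 1 ⬝ᵥ (A *ᵥ Pi.single j 1)) / 2 := by
  have := hA.apply i j
  simp only [mulVec_add, add_dotProduct, dotProduct_add, single_dotProduct, mulVec_single_one]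
  simp [col_apply]
  linarith

section Calculus

attribute [local instance] Matrix.linftyOpNormedAddCommGroup Matrix.linftyOpNormedSpace
  Matrix.linftyOpNormedRing Matrix.linftyOpNormedAlgebra

theorem _root_.LinearMap.comp_hasDerivAt {E F : Type*} [NormedAddCommGroup E] [NormedSpace ℝ E]
    [FiniteDimensional ℝ E] [NormedAddCommGroup F] [NormedSpace ℝ F] (L : E →ₗ[ℝ] F)
    {f : ℝ → E} {f' : E} {t : ℝ} (hf : HasDerivAt f f' t) :
    HasDerivAt (fun s => L (f s)) (L f') t :=
  (L.toContinuousLinearMap.hasFDerivAt (x := f t)).comp_hasDerivAt t hf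

theorem hasDerivAt_transpose {f : ℝ → Matrix κ ι ℝ} {f' : Matrix κ ι ℝ} {t : ℝ}
    (hf : HasDerivAt f f' t) : HasDerivAt (fun s => (f s)ᵀ) f'ᵀ t :=
  (transposeLinearEquiv κ ι ℝ ℝ).toLinearMap.comp_hasDerivAt hf

theorem hasDerivAt_apply {f : ℝ → Matrix κ ι ℝ} {f' : Matrix κ ι ℝ} {t : ℝ}
    (hf : HasDerivAt f f' t) (i : κ) (j : ι) : HasDerivAt (fun s => f s i j) (f' i j) t :=
  (entryLinearMap ℝ ℝ i j).comp_hasDerivAt hf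

theorem hasDerivWithinAt_of_apply [DecidableEq ι] [DecidableEq κ] {f : ℝ → Matrix κ ι ℝ} {f' : Matrix κ ι ℝ} {s : Set ℝ} {t : ℝ}
    (hf : ∀ i j, HasDerivWithinAt (fun s => f s i j) (f' i j) s t) : HasDerivWithinAt f f' s t := by
  have : f = fun s => ∑ i, ∑ j, f s i j • Matrix.single i j (1 : ℝ) := by
    funext s
    conv_lhs => rw [matrix_eq_sum_single (f s)]
    simp
  rw [this, matrix_eq_sum_single f']
  refine HasDerivWithinAt.fun_sum fun i _ => HasDerivWithinAt.fun_sum fun j _ => ?_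
  have := (hf i j).smul_const (Matrix.single i j (1 : ℝ))
  simpa using this

theorem hasDerivAt_dotProduct {f g : ℝ → ι → ℝ} {f' g' : ι → ℝ} {t : ℝ}
    (hf : HasDerivAt f f' t) (hg : HasDerivAt g g' t) :
    HasDerivAt (fun s => f s ⬝ᵥ g s) (f' ⬝ᵥ g t + f t ⬝ᵥ g') t := by
  rw [hasDerivAt_pi] at hf hg
  simp only [dotProduct, ← Finset.sum_add_distrib]
  exact HasDerivAt.fun_sum fun i _ => (hf i).mul (hg i)

theorem hasDerivAt_mulVec {f : ℝ → Matrix κ ι ℝ} {f' : Matrix κ ι ℝ} {g : ℝ → ι → ℝ} {g' : ι → ℝ}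
    {t : ℝ} (hf : HasDerivAt f f' t) (hg : HasDerivAt g g' t) :
    HasDerivAt (fun s => f s *ᵥ g s) (f' *ᵥ g t + f t *ᵥ g') t := by
  rw [hasDerivAt_pi] at hg ⊢
  intro i
  simp only [mulVec, dotProduct, Pi.add_apply, ← Finset.sum_add_distrib]
  exact HasDerivAt.fun_sum fun j _ => (hasDerivAt_apply hf i j).mul (hg j)

theorem hasDerivAt_const_mulVec (A : Matrix κ ι ℝ) {g : ℝ → ι → ℝ} {g' : ι → ℝ} {t : ℝ}
    (hg : HasDerivAt g g' t) : HasDerivAt (fun s => A *ᵥ g s) (A *ᵥ g') t :=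
  (mulVecLin A).comp_hasDerivAt hg

theorem hasDerivAt_inv [DecidableEq ι] {f : ℝ → Matrix ι ι ℝ} {f' : Matrix ι ι ℝ} {t : ℝ}
    (hf : HasDerivAt f f' t) (h : IsUnit (f t)) :
    HasDerivAt (fun s => (f s)⁻¹) (-((f t)⁻¹ * f' * (f t)⁻¹)) t := by
  obtain ⟨u, hu⟩ := h
  have h1 := hasFDerivAt_ringInverse (𝕜 := ℝ) u
  rw [hu] at h1
  have h2 := h1.comp_hasDerivAt t hf
  have h3 : ((u⁻¹ : (Matrix ι ι ℝ)ˣ) : Matrix ι ι ℝ) = (f t)⁻¹ := by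
    rw [← hu, Matrix.coe_units_inv]
  rw [show (fun s => (f s)⁻¹) = fun s => Ring.inverse (f s) from
    funext fun s => nonsing_inv_eq_ringInverse (f s)]
  have h4 : (-((ContinuousLinearMap.mulLeftRight ℝ (Matrix ι ι ℝ)) ↑u⁻¹) ↑u⁻¹) f' =
      -((f t)⁻¹ * f' * (f t)⁻¹) := by simp [h3]
  rw [h4] at h2
  exact h2

theorem hasDerivAt_exp_smul_mulVec [DecidableEq ι] (A : Matrix ι ι ℝ) (v : ι → ℝ) (t : ℝ) :
    HasDerivAt (fun s : ℝ => NormedSpace.exp (s • A) *ᵥ v)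
      (A *ᵥ (NormedSpace.exp (t • A) *ᵥ v)) t := by
  have h := hasDerivAt_mulVec (hasDerivAt_exp_smul_const' (𝕂 := ℝ) A t) (hasDerivAt_const t v)
  rw [mulVec_zero, add_zero, ← mulVec_mulVec] at h
  exact h

end Calculus

end Matrix

/-! ### Lyapunov certificates from the spectrum, through the Cayley transform. -/

namespace Matrix

variable {ι : Type*} [Fintype ι]

/-- Lyapunov stability of a real square matrix: there is a positive definite `W` with
`Fᵀ W + W F` negative definite. -/
def LyapunovStable (F : Matrix ι ι ℝ) : Prop :=
  ∃ (W : Matrix ι ι ℝ) (c : ℝ), W.IsSymm ∧ 0 < c ∧ (∀ x, c * (x ⬝ᵥ x) ≤ x ⬝ᵥ (W *ᵥ x)) ∧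
    ∀ x, (W *ᵥ x) ⬝ᵥ (F *ᵥ x) ≤ -c * (x ⬝ᵥ x)

theorem exists_mul_dotProduct_le_of_isUnit [DecidableEq ι] {A : Matrix ι ι ℝ} (hA : IsUnit A) :
    ∃ c : ℝ, 0 < c ∧ ∀ x, c * (x ⬝ᵥ x) ≤ (A *ᵥ x) ⬝ᵥ (A *ᵥ x) := by
  obtain ⟨c, hc, h⟩ := exists_mulVec_dotProduct_self_le A⁻¹
  refine ⟨c⁻¹, by positivity, fun x => ?_⟩
  have := h (A *ᵥ x)
  rw [mulVec_mulVec, nonsing_inv_mul _ ((isUnit_iff_isUnit_det A).mp hA), one_mulVec] at this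
  rw [inv_mul_le_iff₀ hc]
  exact this

/-- If a power of `E` is a strict contraction, then the Cayley transform `G` of `E` is stable. -/
theorem lyapunovStable_of_cayley [DecidableEq ι] {E G : Matrix ι ι ℝ} (hG : IsUnit (G - 1))
    (hE : E * (G - 1) = G + 1) {k : ℕ} (hk : 0 < k)
    (hEk : ∀ x, 2 * ((E ^ k *ᵥ x) ⬝ᵥ (E ^ k *ᵥ x)) ≤ x ⬝ᵥ x) : LyapunovStable G := by
  obtain ⟨c, hc, hcG⟩ := exists_mul_dotProduct_le_of_isUnit hG
  set W : Matrix ι ι ℝ := ∑ j ∈ Finset.range k, (E ^ j)ᵀ * E ^ j with hW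
  have hWs : W.IsSymm := by
    rw [IsSymm, hW, transpose_sum]
    exact Finset.sum_congr rfl fun j _ => by simp [transpose_mul]
  have hWx : ∀ x, x ⬝ᵥ (W *ᵥ x) = ∑ j ∈ Finset.range k, (E ^ j *ᵥ x) ⬝ᵥ (E ^ j *ᵥ x) := by
    intro x
    rw [hW, sum_mulVec, dotProduct_sum]
    exact Finset.sum_congr rfl fun j _ => by rw [← mulVec_mulVec, mulVec_dotProduct_eq]
  -- The sum defining `W` telescopes, so `W` solves a Stein equation for `E` up to the small term `E
  -- ^ k`.
  have hstein : ∀ y, (E *ᵥ y) ⬝ᵥ (W *ᵥ (E *ᵥ y)) - y ⬝ᵥ (W *ᵥ y)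
      = (E ^ k *ᵥ y) ⬝ᵥ (E ^ k *ᵥ y) - y ⬝ᵥ y := by
    intro y
    rw [hWx, hWx, ← Finset.sum_sub_distrib]
    have := Finset.sum_range_sub (fun j => (E ^ j *ᵥ y) ⬝ᵥ (E ^ j *ᵥ y)) k
    simpa [mulVec_mulVec, ← pow_succ] using this
  -- The term `j = 0` of the sum gives the lower bound 1. With `y = (G - 1) x` the Stein identity
  -- reads `4 Wx·Gx ≤ -½ |(G - 1) x|² ≤ -(c / 2) |x|²`, whence `c / 8`.
  refine ⟨W, min 1 (c / 8), hWs, by positivity, fun x => ?_, fun x => ?_⟩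
  · have h1 : x ⬝ᵥ x ≤ x ⬝ᵥ (W *ᵥ x) := by
      rw [hWx]
      have := Finset.single_le_sum (f := fun j => (E ^ j *ᵥ x) ⬝ᵥ (E ^ j *ᵥ x))
        (fun j _ => dotProduct_self_nonneg _) (Finset.mem_range.mpr hk)
      simpa using this
    have := mul_le_mul_of_nonneg_right (min_le_left 1 (c / 8)) (dotProduct_self_nonneg x)
    linarith
  · have h1 := hstein ((G - 1) *ᵥ x)
    rw [mulVec_mulVec x E, hE] at h1
    have h2 := hEk ((G - 1) *ᵥ x)
    have h3 := hcG x
    have h4 := dotProduct_mulVec_comm hWs x (G *ᵥ x)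
    have h5 : (W *ᵥ x) ⬝ᵥ (G *ᵥ x) = (G *ᵥ x) ⬝ᵥ (W *ᵥ x) := dotProduct_comm _ _
    have h6 := mul_le_mul_of_nonneg_right (min_le_right 1 (c / 8)) (dotProduct_self_nonneg x)
    have h7 : ((G + 1) *ᵥ x) ⬝ᵥ (W *ᵥ ((G + 1) *ᵥ x)) -
        ((G - 1) *ᵥ x) ⬝ᵥ (W *ᵥ ((G - 1) *ᵥ x)) = 4 * ((W *ᵥ x) ⬝ᵥ (G *ᵥ x)) := by
      simp only [add_mulVec, sub_mulVec, one_mulVec, mulVec_add, mulVec_sub, add_dotProduct,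
        sub_dotProduct, dotProduct_add, dotProduct_sub]
      linarith
    linarith

section Spectral

attribute [local instance] Matrix.linftyOpNormedAddCommGroup Matrix.linftyOpNormedSpace
  Matrix.linftyOpNormedRing Matrix.linftyOpNormedAlgebra

/-- Gelfand's formula: the `k`-th roots of `‖A ^ k‖` tend to the spectral radius, which is below 1.
The empty spectrum (size zero) needs separate treatment. -/
theorem tendsto_pow_of_spectrum [DecidableEq ι] (A : Matrix ι ι ℂ)
    (hA : ∀ z ∈ spectrum ℂ A, ‖z‖ < 1) : Tendsto (fun k => A ^ k) atTop (𝓝 0) := by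
  have h1 : spectralRadius ℂ A < 1 := by
    rcases (spectrum ℂ A).eq_empty_or_nonempty with h | h
    · simp [spectralRadius, h]
    · exact spectrum.spectralRadius_lt_of_forall_lt_of_nonempty h fun z hz => hA z hz
  obtain ⟨r, hr1, hr2⟩ := ENNReal.lt_iff_exists_nnreal_btwn.mp h1
  have h2 := (spectrum.pow_nnnorm_pow_one_div_tendsto_nhds_spectralRadius A).eventually_lt_const hr1
  have h3 : Tendsto (fun k => (r : ℝ) ^ k) atTop (𝓝 0) :=
    tendsto_pow_atTop_nhds_zero_of_lt_one r.2 (by exact_mod_cast hr2)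
  refine squeeze_zero_norm' ?_ h3
  filter_upwards [h2, eventually_gt_atTop 0] with k hk hk0
  have h4 : ((‖A ^ k‖₊ : ENNReal) ^ (1 / (k : ℝ))) ^ (k : ℝ) ≤ (r : ENNReal) ^ (k : ℝ) :=
    ENNReal.rpow_le_rpow hk.le (by positivity)
  rw [← ENNReal.rpow_mul, one_div, inv_mul_cancel₀ (by positivity), ENNReal.rpow_one,
    ENNReal.rpow_natCast] at h4
  exact_mod_cast h4

end Spectral

/-- A matrix all of whose complex eigenvalues have negative real part is Lyapunov stable. -/
theorem _root_.IsStableMatrix.lyapunovStable {n : ℕ} {G : Matrix (Fin n) (Fin n) ℝ}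
    (hG : IsStableMatrix G) : LyapunovStable G := by
  set φ : Matrix (Fin n) (Fin n) ℝ →+* Matrix (Fin n) (Fin n) ℂ := Complex.ofRealHom.mapMatrix
  have hφ : ∀ A i j, φ A i j = (A i j : ℂ) := fun A i j => rfl
  have hres : ∀ w : ℂ, 0 ≤ w.re → IsUnit (algebraMap ℂ _ w - φ G) := by
    intro w hw
    by_contra h
    exact absurd (hG w (spectrum.mem_iff.mpr h)) (not_lt.mpr hw)
  have hGc : IsUnit (φ G - 1) := by
    have := (hres 1 (by simp)).neg
    rwa [map_one, neg_sub] at this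
  have hGu : IsUnit (G - 1) := by
    rw [isUnit_iff_isUnit_det, isUnit_iff_ne_zero]
    have h1 : φ (G - 1) = φ G - 1 := by simp
    rw [← h1, isUnit_iff_isUnit_det, isUnit_iff_ne_zero] at hGc
    intro h0
    apply hGc
    have : (φ (G - 1)).det = Complex.ofRealHom (G - 1).det := (RingHom.map_det _ _).symm
    rw [this, h0, map_zero]
  set E := (G + 1) * (G - 1)⁻¹
  have hE : E * (G - 1) = G + 1 := by
    rw [mul_assoc, nonsing_inv_mul _ ((isUnit_iff_isUnit_det _).mp hGu), mul_one]
  have hEc : φ E * (φ G - 1) = φ G + 1 := by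
    have := congrArg φ hE
    simpa using this
  have hspec : ∀ z ∈ spectrum ℂ (φ E), ‖z‖ < 1 := by
    intro z hz
    by_contra hz1
    push Not at hz1
    refine spectrum.mem_iff.mp hz ?_
    suffices h : IsUnit ((algebraMap ℂ _ z - φ E) * (φ G - 1)) by
      have h2 := h.mul (hGc.unit⁻¹).isUnit
      rwa [mul_assoc, IsUnit.mul_val_inv, mul_one] at h2
    rw [sub_mul, hEc]
    rcases eq_or_ne z 1 with rfl | hne
    · have : algebraMap ℂ (Matrix (Fin n) (Fin n) ℂ) 1 * (φ G - 1) - (φ G + 1)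
          = algebraMap ℂ _ (-2) := by
        rw [map_one, one_mul, map_neg, map_ofNat]
        rw [← one_add_one_eq_two]
        abel
      rw [this]
      exact (isUnit_iff_ne_zero.mpr (by norm_num)).map (algebraMap ℂ _)
    -- The Cayley map pulls `z` back to `(z + 1) / (z - 1)`, which has real part `(|z|² - 1) / |z -
    -- 1|² ≥ 0` and therefore lies in the resolvent set of `G`.
    · have hz0 : z - 1 ≠ 0 := sub_ne_zero.mpr hne
      have : algebraMap ℂ (Matrix (Fin n) (Fin n) ℂ) z * (φ G - 1) - (φ G + 1)
          = -(algebraMap ℂ _ (z - 1) * (algebraMap ℂ _ ((z + 1) / (z - 1)) - φ G)) := by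
        rw [mul_sub (algebraMap ℂ _ (z - 1)), ← map_mul, mul_div_cancel₀ _ hz0, map_sub, map_add, map_one]
        noncomm_ring
      rw [this]
      refine (((isUnit_iff_ne_zero.mpr hz0).map (algebraMap ℂ _)).mul (hres _ ?_)).neg
      rw [Complex.div_re, ← add_div]
      refine div_nonneg ?_ (Complex.normSq_nonneg _)
      have h1 : 1 ≤ Complex.normSq z := by
        rw [Complex.normSq_eq_norm_sq]
        nlinarith
      rw [Complex.normSq_apply] at h1
      simp
      nlinarith
  have hlim := tendsto_pow_of_spectrum (φ E) hspec
  -- The squared Frobenius norm dominates the squared operator norm; once it is below 1/2 the power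
  -- is the contraction required.
  have hlim2 : Tendsto (fun k => ∑ i, ∑ j, (E ^ k) i j ^ 2) atTop (𝓝 0) := by
    have : Tendsto (fun k => ∑ i, ∑ j, (E ^ k) i j ^ 2) atTop
        (𝓝 (∑ i : Fin n, ∑ j : Fin n, (0 : ℝ) ^ 2)) := by
      refine tendsto_finsetSum _ fun i _ => tendsto_finsetSum _ fun j _ => Tendsto.pow ?_ 2
      have h1 := (hlim.apply_nhds i).apply_nhds j
      have h2 := (Complex.continuous_re.tendsto _).comp h1
      refine (h2.congr fun k => ?_)
      simp only [Function.comp_apply, ← map_pow, hφ, Complex.ofReal_re]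
    simpa using this
  obtain ⟨k, hk, hk0⟩ := ((hlim2.eventually_lt_const (show (0 : ℝ) < 1 / 2 by norm_num)).and
    (eventually_gt_atTop 0)).exists
  refine lyapunovStable_of_cayley hGu hE hk0 fun x => ?_
  have h : (E ^ k *ᵥ x) ⬝ᵥ (E ^ k *ᵥ x) ≤ (∑ i, ∑ j, (E ^ k) i j ^ 2) * (x ⬝ᵥ x) := by
    rw [Finset.sum_mul]
    refine Finset.sum_le_sum fun i _ => ?_
    have := Finset.sum_mul_sq_le_sq_mul_sq Finset.univ ((E ^ k) i) x
    simpa [mulVec, dotProduct, sq] using this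
  have := mul_le_mul_of_nonneg_right hk.le (dotProduct_self_nonneg x)
  linarith

end Matrix

/-! ### Consequences of stability: openness, decay, Sylvester and Lyapunov equations. -/

namespace Matrix

/-- A nonnegative function with `v' ≤ -a v + g`, where `a > 0` and `g → 0`, tends to zero. -/
theorem _root_.tendsto_zero_of_deriv_le {v v' g : ℝ → ℝ} {a : ℝ} (ha : 0 < a)
    (hv0 : ∀ t, 0 ≤ v t) (hd : ∀ᶠ t in atTop, HasDerivAt v (v' t) t)
    (hle : ∀ᶠ t in atTop, v' t ≤ -a * v t + g t) (hg : Tendsto g atTop (𝓝 0)) :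
    Tendsto v atTop (𝓝 0) := by
  rw [Metric.tendsto_atTop]
  intro η hη
  have hη2 : 0 < a * (η / 2) := by positivity
  obtain ⟨t₀, ht₀⟩ := eventually_atTop.mp ((hd.and hle).and (hg.eventually_lt_const hη2))
  -- Beyond `t₀` the forcing is below `a η / 2`, so the excess of `v` over `η / 2` decays at least
  -- like `exp (-a t)`.
  have hanti : AntitoneOn (fun t => Real.exp (a * t) * (v t - η / 2)) (Ici t₀) := by
    have hder : ∀ t ∈ Ici t₀, HasDerivAt (fun t => Real.exp (a * t) * (v t - η / 2))
        (Real.exp (a * t) * a * (v t - η / 2) + Real.exp (a * t) * v' t) t := by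
      intro t ht
      have h1 : HasDerivAt (fun t => Real.exp (a * t)) (Real.exp (a * t) * a) t := by
        simpa using ((hasDerivAt_id t).const_mul a).exp
      exact h1.mul ((ht₀ t ht).1.1.sub_const _)
    refine antitoneOn_of_hasDerivWithinAt_nonpos (convex_Ici t₀)
      (fun t ht => (hder t ht).continuousAt.continuousWithinAt)
      (fun t ht => (hder t (interior_subset ht)).hasDerivWithinAt) fun t ht => ?_
    have h := ht₀ t (interior_subset ht)
    have h2 : a * (v t - η / 2) + v' t ≤ 0 := by linarith [h.1.2, h.2]
    have := mul_nonpos_of_nonneg_of_nonpos (Real.exp_pos (a * t)).le h2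
    linarith
  have hexp : Tendsto (fun t => Real.exp (-(a * t)) * (Real.exp (a * t₀) * |v t₀ - η / 2|)) atTop
      (𝓝 (0 * (Real.exp (a * t₀) * |v t₀ - η / 2|))) := by
    refine Tendsto.mul_const _ ?_
    exact Real.tendsto_exp_neg_atTop_nhds_zero.comp (tendsto_id.const_mul_atTop ha)
  rw [zero_mul] at hexp
  obtain ⟨t₁, ht₁⟩ := eventually_atTop.mp (hexp.eventually_lt_const (half_pos hη))
  refine ⟨max t₀ t₁, fun t ht => ?_⟩
  have h1 := hanti (mem_Ici.mpr le_rfl) (mem_Ici.mpr (le_of_max_le_left ht))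
    (le_of_max_le_left ht)
  have h2 := ht₁ t (le_of_max_le_right ht)
  simp only at h1
  have h3 : v t - η / 2 ≤ Real.exp (-(a * t)) * (Real.exp (a * t₀) * |v t₀ - η / 2|) := by
    have h4 := mul_le_mul_of_nonneg_left h1 (Real.exp_pos (-(a * t))).le
    rw [← mul_assoc, ← Real.exp_add, neg_add_cancel, Real.exp_zero, one_mul] at h4
    refine h4.trans (mul_le_mul_of_nonneg_left ?_ (Real.exp_pos _).le)
    exact mul_le_mul_of_nonneg_left (le_abs_self _) (Real.exp_pos _).le
  rw [Real.dist_eq, sub_zero, abs_of_nonneg (hv0 t)]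
  linarith

variable {ι : Type*} [Fintype ι]

theorem tendsto_zero_of_dotProduct_self {α : Type*} {l : Filter α} {e : α → ι → ℝ}
    (h : Tendsto (fun t => e t ⬝ᵥ e t) l (𝓝 0)) : Tendsto e l (𝓝 0) := by
  rw [tendsto_pi_nhds]
  intro i
  have h1 : Tendsto (fun t => Real.sqrt (e t ⬝ᵥ e t)) l (𝓝 0) := by
    have := (Real.continuous_sqrt.tendsto 0).comp h
    rwa [Real.sqrt_zero] at this
  refine squeeze_zero_norm (fun t => ?_) h1
  rw [Real.norm_eq_abs]
  exact Real.abs_le_sqrt (sq_le_dotProduct_self _ i)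

namespace LyapunovStable

/-- A single form `W` certifies a whole neighbourhood of `F`: Young's inequality charges the
perturbation to half of the margin `c`. The uniform `W` is what time-dependent coefficients
converging to `F` require. -/
theorem eventually_nhds {F : Matrix ι ι ℝ} (hF : LyapunovStable F) :
    ∃ (W : Matrix ι ι ℝ) (c : ℝ), W.IsSymm ∧ 0 < c ∧ (∀ x, c * (x ⬝ᵥ x) ≤ x ⬝ᵥ (W *ᵥ x)) ∧
      ∀ᶠ A in 𝓝 F, ∀ x, (W *ᵥ x) ⬝ᵥ (A *ᵥ x) ≤ -c * (x ⬝ᵥ x) := by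
  obtain ⟨W, c, hW, hc, hpos, hneg⟩ := hF
  obtain ⟨C, hC, hCW⟩ := exists_mulVec_dotProduct_self_le W
  refine ⟨W, c / 2, hW, by positivity, fun x => ?_, ?_⟩
  · have := mul_nonneg hc.le (dotProduct_self_nonneg x)
    linarith [hpos x]
  have hlim : Tendsto (fun A : Matrix ι ι ℝ => ∑ i, ∑ j, ((A - F) i j) ^ 2) (𝓝 F) (𝓝 0) := by
    have : Continuous (fun A : Matrix ι ι ℝ => ∑ i, ∑ j, ((A - F) i j) ^ 2) := by fun_prop
    simpa using this.tendsto F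
  have hε : 0 < c / 2 / C := by positivity
  filter_upwards [hlim.eventually_lt_const (show 0 < c / 2 * (c / 2 / C) by positivity)] with A hA x
  have h1 : ((A - F) *ᵥ x) ⬝ᵥ ((A - F) *ᵥ x) ≤ (∑ i, ∑ j, ((A - F) i j) ^ 2) * (x ⬝ᵥ x) := by
    rw [Finset.sum_mul]
    refine Finset.sum_le_sum fun i _ => ?_
    have := Finset.sum_mul_sq_le_sq_mul_sq Finset.univ ((A - F) i) x
    simpa [mulVec, dotProduct, sq] using this
  have h2 := two_mul_dotProduct_le hε (W *ᵥ x) ((A - F) *ᵥ x)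
  have h3 : c / 2 / C * ((W *ᵥ x) ⬝ᵥ (W *ᵥ x)) ≤ c / 2 * (x ⬝ᵥ x) := by
    have := mul_le_mul_of_nonneg_left (hCW x) hε.le
    rwa [← mul_assoc, div_mul_cancel₀ _ hC.ne'] at this
  have h4 : (c / 2 / C)⁻¹ * (((A - F) *ᵥ x) ⬝ᵥ ((A - F) *ᵥ x)) ≤ c / 2 * (x ⬝ᵥ x) := by
    rw [inv_mul_le_iff₀ hε]
    have := mul_le_mul_of_nonneg_right hA.le (dotProduct_self_nonneg x)
    linarith
  rw [sub_mulVec, dotProduct_sub] at h2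
  have := hneg x
  rw [sub_mulVec] at h4
  linarith

theorem eventually_stable {F : Matrix ι ι ℝ} (hF : LyapunovStable F) :
    ∀ᶠ A in 𝓝 F, LyapunovStable A := by
  obtain ⟨W, c, hW, hc, hpos, hneg⟩ := hF.eventually_nhds
  filter_upwards [hneg] with A hA
  exact ⟨W, c, hW, hc, hpos, hA⟩

theorem isUnit [DecidableEq ι] {F : Matrix ι ι ℝ} (hF : LyapunovStable F) : IsUnit F := by
  obtain ⟨W, c, hW, hc, hpos, hneg⟩ := hF
  rw [← mulVec_injective_iff_isUnit]
  intro x y hxy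
  have h := hneg (x - y)
  change F *ᵥ x = F *ᵥ y at hxy
  rw [mulVec_sub F, hxy, sub_self, dotProduct_zero] at h
  by_contra hne
  have := mul_pos hc (dotProduct_self_pos (sub_ne_zero.mpr hne))
  linarith

/-- The inverse form `W⁻¹` is a certificate for `Fᵀ`, by the substitution `x ↦ W⁻¹ x`. -/
theorem transpose [DecidableEq ι] {F : Matrix ι ι ℝ} (hF : LyapunovStable F) :
    LyapunovStable Fᵀ := by
  obtain ⟨W, c, hW, hc, hpos, hneg⟩ := hF
  have hWu : IsUnit W := by
    rw [← mulVec_injective_iff_isUnit]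
    intro x y hxy
    have h := hpos (x - y)
    change W *ᵥ x = W *ᵥ y at hxy
    rw [mulVec_sub W, hxy, sub_self, dotProduct_zero] at h
    by_contra hne
    have := mul_pos hc (dotProduct_self_pos (sub_ne_zero.mpr hne))
    linarith
  obtain ⟨C, hC, hCW⟩ := exists_mulVec_dotProduct_self_le W
  have hWi : ∀ x, W *ᵥ (W⁻¹ *ᵥ x) = x := fun x => by
    rw [mulVec_mulVec, mul_nonsing_inv _ ((isUnit_iff_isUnit_det W).mp hWu), one_mulVec]
  have key : ∀ x, c / C * (x ⬝ᵥ x) ≤ c * ((W⁻¹ *ᵥ x) ⬝ᵥ (W⁻¹ *ᵥ x)) := fun x => by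
    rw [div_mul_eq_mul_div, div_le_iff₀ hC, mul_assoc]
    refine mul_le_mul_of_nonneg_left ?_ hc.le
    have := hCW (W⁻¹ *ᵥ x)
    rw [hWi] at this
    linarith
  refine ⟨W⁻¹, c / C, ?_, by positivity, fun x => ?_, fun x => ?_⟩
  · rw [IsSymm, transpose_nonsing_inv, hW.eq]
  · have := hpos (W⁻¹ *ᵥ x)
    rw [hWi, dotProduct_comm (W⁻¹ *ᵥ x) x] at this
    exact (key x).trans this
  · have := hneg (W⁻¹ *ᵥ x)
    rw [hWi, dotProduct_mulVec_eq, dotProduct_comm] at this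
    linarith [key x]

section Decay

variable {F : Matrix ι ι ℝ}

/-- Solutions of an asymptotically autonomous stable linear equation with vanishing forcing
tend to zero. -/
theorem tendsto_zero [DecidableEq ι] (hF : LyapunovStable F) {A : ℝ → Matrix ι ι ℝ}
    {e h : ℝ → ι → ℝ} (hd : ∀ t, 0 ≤ t → HasDerivAt e (A t *ᵥ e t + h t) t)
    (hA : Tendsto A atTop (𝓝 F)) (hh : Tendsto h atTop (𝓝 0)) : Tendsto e atTop (𝓝 0) := by
  obtain ⟨W, c, hW, hc, hpos, hneg⟩ := hF.eventually_nhds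
  obtain ⟨C, hC, hCW⟩ := exists_mulVec_dotProduct_self_le W
  obtain ⟨C', hC', hCW'⟩ := exists_abs_dotProduct_mulVec_le W
  have hV0 : ∀ t, 0 ≤ e t ⬝ᵥ (W *ᵥ e t) := fun t =>
    (mul_nonneg hc.le (dotProduct_self_nonneg _)).trans (hpos _)
  have hε : 0 < c / C := by positivity
  -- The form `W` is a Lyapunov function: half of the dissipation absorbs the forcing by Young's
  -- inequality, and the rest bounds the derivative by `-(c / C') V`.
  have hV : Tendsto (fun t => e t ⬝ᵥ (W *ᵥ e t)) atTop (𝓝 0) := by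
    refine tendsto_zero_of_deriv_le (a := c / C') (g := fun t => (c / C)⁻¹ * (h t ⬝ᵥ h t))
      (v' := fun t => (A t *ᵥ e t + h t) ⬝ᵥ (W *ᵥ e t) + e t ⬝ᵥ (W *ᵥ (A t *ᵥ e t + h t)))
      (by positivity) hV0 ?_ ?_ ?_
    · filter_upwards [eventually_ge_atTop 0] with t ht
      exact hasDerivAt_dotProduct (hd t ht) (hasDerivAt_const_mulVec W (hd t ht))
    · filter_upwards [hA.eventually hneg] with t ht
      have h1 := ht (e t)
      have h2 := two_mul_dotProduct_le hε (W *ᵥ e t) (h t)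
      have h3 : c / C * ((W *ᵥ e t) ⬝ᵥ (W *ᵥ e t)) ≤ c * (e t ⬝ᵥ e t) := by
        have := mul_le_mul_of_nonneg_left (hCW (e t)) hε.le
        rwa [← mul_assoc, div_mul_cancel₀ _ hC.ne'] at this
      have h4 : c / C' * (e t ⬝ᵥ (W *ᵥ e t)) ≤ c * (e t ⬝ᵥ e t) := by
        rw [div_mul_eq_mul_div, div_le_iff₀ hC', mul_assoc]
        refine mul_le_mul_of_nonneg_left ?_ hc.le
        linarith [le_abs_self (e t ⬝ᵥ (W *ᵥ e t)), hCW' (e t)]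
      have h5 : e t ⬝ᵥ (W *ᵥ (A t *ᵥ e t + h t)) = (A t *ᵥ e t + h t) ⬝ᵥ (W *ᵥ e t) :=
        dotProduct_mulVec_comm hW _ _
      rw [h5, dotProduct_comm, dotProduct_add]
      linarith
    · have h1 : Tendsto (fun t => h t ⬝ᵥ h t) atTop (𝓝 0) := by
        have h3 : Continuous fun x : ι → ℝ => x ⬝ᵥ x := by fun_prop
        have := (h3.tendsto 0).comp hh
        rwa [dotProduct_zero] at this
      simpa using h1.const_mul (c / C)⁻¹
  refine tendsto_zero_of_dotProduct_self
    (squeeze_zero (fun t => dotProduct_self_nonneg _) (fun t => ?_) (g := fun t =>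
      c⁻¹ * (e t ⬝ᵥ (W *ᵥ e t))) (by simpa using hV.const_mul c⁻¹))
  rw [le_inv_mul_iff₀ hc]
  exact hpos _

theorem tendsto_exp [DecidableEq ι] (hF : LyapunovStable F) (x : ι → ℝ) :
    Tendsto (fun t : ℝ => NormedSpace.exp (t • F) *ᵥ x) atTop (𝓝 0) :=
  hF.tendsto_zero (A := fun _ => F) (h := fun _ => 0)
    (fun t _ => by simpa using hasDerivAt_exp_smul_mulVec F x t) tendsto_const_nhds
    tendsto_const_nhds

theorem tendsto_dotProduct_exp [DecidableEq ι] {F₁ F₂ : Matrix ι ι ℝ} (h₁ : LyapunovStable F₁)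
    (h₂ : LyapunovStable F₂) (D : Matrix ι ι ℝ) (x y : ι → ℝ) :
    Tendsto (fun t : ℝ => (NormedSpace.exp (t • F₁) *ᵥ x) ⬝ᵥ
      (D *ᵥ (NormedSpace.exp (t • F₂) *ᵥ y))) atTop (𝓝 0) := by
  have h : Continuous fun z : (ι → ℝ) × (ι → ℝ) => z.1 ⬝ᵥ (D *ᵥ z.2) := by fun_prop
  have := (h.tendsto (0, 0)).comp ((h₁.tendsto_exp x).prodMk_nhds (h₂.tendsto_exp y))
  rwa [zero_dotProduct] at this

theorem hasDerivAt_dotProduct_exp [DecidableEq ι] (F₁ F₂ D : Matrix ι ι ℝ) (x y : ι → ℝ) (t : ℝ) :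
    HasDerivAt (fun t : ℝ => (NormedSpace.exp (t • F₁) *ᵥ x) ⬝ᵥ
      (D *ᵥ (NormedSpace.exp (t • F₂) *ᵥ y)))
      ((NormedSpace.exp (t • F₁) *ᵥ x) ⬝ᵥ ((F₁ᵀ * D + D * F₂) *ᵥ
        (NormedSpace.exp (t • F₂) *ᵥ y))) t := by
  have h2 := hasDerivAt_const_mulVec D (hasDerivAt_exp_smul_mulVec F₂ y t)
  have h := hasDerivAt_dotProduct (hasDerivAt_exp_smul_mulVec F₁ x t) h2
  convert h using 1
  generalize NormedSpace.exp (t • F₁) *ᵥ x = u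
  generalize NormedSpace.exp (t • F₂) *ᵥ y = v
  rw [mulVec_dotProduct_eq F₁, ← dotProduct_add, add_mulVec, mulVec_mulVec, mulVec_mulVec]

/-- The Sylvester equation with stable coefficients has only the trivial solution. -/
theorem eq_zero_of_sylvester [DecidableEq ι] {F₁ F₂ D : Matrix ι ι ℝ} (h₁ : LyapunovStable F₁)
    (h₂ : LyapunovStable F₂) (h : F₁ᵀ * D + D * F₂ = 0) : D = 0 := by
  refine ext_dotProduct_mulVec fun x y => ?_
  -- The pairing of `exp(t F₁) x` with `D exp(t F₂) y` has zero derivative by the equation, and it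
  -- decays to zero; so it vanishes already at `t = 0`.
  have hd := hasDerivAt_dotProduct_exp F₁ F₂ D x y
  simp only [h, zero_mulVec, dotProduct_zero] at hd
  have hconst := is_const_of_deriv_eq_zero (fun t => (hd t).differentiableAt)
    (fun t => (hd t).deriv)
  have hl := (h₁.tendsto_dotProduct_exp h₂ D x y).congr fun t => hconst t 0
  have := tendsto_nhds_unique hl tendsto_const_nhds
  simpa using this.symm

/-- A solution of a Lyapunov inequality with stable coefficient is positive semidefinite. -/
theorem dotProduct_mulVec_nonneg [DecidableEq ι] {V : Matrix ι ι ℝ} (hF : LyapunovStable F)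
    (h : ∀ x, x ⬝ᵥ ((Fᵀ * V + V * F) *ᵥ x) ≤ 0) (x : ι → ℝ) : 0 ≤ x ⬝ᵥ (V *ᵥ x) := by
  have hd := hasDerivAt_dotProduct_exp F F V x x
  have hanti := antitone_of_hasDerivAt_nonpos hd fun t => h _
  have := hanti.le_of_tendsto (hF.tendsto_dotProduct_exp hF V x x) 0
  simpa using this

end Decay

end LyapunovStable

end Matrix

/-! ### The Hamiltonian linear system and the Riccati flow. -/

namespace Matrix

theorem PosSemidef.real_isSymm {κ : Type*} {R : Matrix κ κ ℝ} (hR : R.PosSemidef) : R.IsSymm := by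
  have := hR.isHermitian
  rwa [IsHermitian, conjTranspose_eq_transpose_of_trivial] at this

variable {ι : Type*} [Fintype ι]

theorem PosSemidef.real_nonneg {R : Matrix ι ι ℝ} (hR : R.PosSemidef) (x : ι → ℝ) :
    0 ≤ x ⬝ᵥ (R *ᵥ x) := by
  simpa using hR.dotProduct_mulVec_nonneg x

/-- The right-hand side `Kᵀ Q + Q K - Q R Q + W` of the linear-quadratic Riccati equation. -/
def riccati (K R W Q : Matrix ι ι ℝ) : Matrix ι ι ℝ := Kᵀ * Q + Q * K - Q * R * Q + W

theorem dotProduct_riccati_mulVec {K R W Q : Matrix ι ι ℝ} (hQ : Q.IsSymm) (x : ι → ℝ) :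
    x ⬝ᵥ (riccati K R W Q *ᵥ x) =
      2 * ((Q *ᵥ x) ⬝ᵥ (K *ᵥ x)) - (Q *ᵥ x) ⬝ᵥ (R *ᵥ (Q *ᵥ x)) + x ⬝ᵥ (W *ᵥ x) := by
  simp only [riccati, add_mulVec, sub_mulVec, dotProduct_add, dotProduct_sub, ← mulVec_mulVec]
  have h1 : x ⬝ᵥ (Kᵀ *ᵥ (Q *ᵥ x)) = (Q *ᵥ x) ⬝ᵥ (K *ᵥ x) := by
    rw [← mulVec_dotProduct_eq, dotProduct_comm]
  have h2 : ∀ y, x ⬝ᵥ (Q *ᵥ y) = (Q *ᵥ x) ⬝ᵥ y := fun y => by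
    rw [mulVec_dotProduct_eq, hQ.eq]
  rw [h1, h2, h2]
  ring

variable [DecidableEq ι]

/-- The Hamiltonian matrix of the linear-quadratic problem. -/
def hamiltonian (K R W : Matrix ι ι ℝ) : Matrix (ι ⊕ ι) (ι ⊕ ι) ℝ := fromBlocks (-K) R W Kᵀ

/-- State block of the Hamiltonian flow. -/
def hamX (K R W : Matrix ι ι ℝ) (t : ℝ) : Matrix ι ι ℝ :=
  (NormedSpace.exp (t • hamiltonian K R W)).toBlocks₁₁

/-- Costate block of the Hamiltonian flow. -/
def hamY (K R W : Matrix ι ι ℝ) (t : ℝ) : Matrix ι ι ℝ :=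
  (NormedSpace.exp (t • hamiltonian K R W)).toBlocks₂₁

/-- The solution of the Riccati differential equation started at zero. -/
def riccatiFlow (K R W : Matrix ι ι ℝ) (t : ℝ) : Matrix ι ι ℝ := hamY K R W t * (hamX K R W t)⁻¹

variable {K R W : Matrix ι ι ℝ}

theorem hamX_zero : hamX K R W 0 = 1 := by
  ext i j
  simp [hamX, toBlocks₁₁, one_apply]

theorem hamY_zero : hamY K R W 0 = 0 := by
  ext i j
  simp [hamY, toBlocks₂₁]

section Calculus

attribute [local instance] Matrix.linftyOpNormedAddCommGroup Matrix.linftyOpNormedSpace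
  Matrix.linftyOpNormedRing Matrix.linftyOpNormedAlgebra

theorem hasDerivAt_hamX (K R W : Matrix ι ι ℝ) (t : ℝ) :
    HasDerivAt (hamX K R W) (-K * hamX K R W t + R * hamY K R W t) t := by
  have h := hasDerivAt_exp_smul_const' (𝕂 := ℝ) (hamiltonian K R W) t
  let L : Matrix (ι ⊕ ι) (ι ⊕ ι) ℝ →ₗ[ℝ] Matrix ι ι ℝ :=
    { toFun := toBlocks₁₁, map_add' := fun _ _ => rfl, map_smul' := fun _ _ => rfl }
  have h1 := L.comp_hasDerivAt h
  have h2 : L (hamiltonian K R W * NormedSpace.exp (t • hamiltonian K R W)) =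
      -K * hamX K R W t + R * hamY K R W t := by
    change toBlocks₁₁ _ = _
    unfold hamX hamY
    generalize NormedSpace.exp (t • hamiltonian K R W) = Z
    conv_lhs => rw [← fromBlocks_toBlocks Z, hamiltonian, fromBlocks_multiply]
    rw [toBlocks_fromBlocks₁₁]
  exact h1.congr_deriv h2

theorem hasDerivAt_hamY (K R W : Matrix ι ι ℝ) (t : ℝ) :
    HasDerivAt (hamY K R W) (W * hamX K R W t + Kᵀ * hamY K R W t) t := by
  have h := hasDerivAt_exp_smul_const' (𝕂 := ℝ) (hamiltonian K R W) t
  let L : Matrix (ι ⊕ ι) (ι ⊕ ι) ℝ →ₗ[ℝ] Matrix ι ι ℝ :=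
    { toFun := toBlocks₂₁, map_add' := fun _ _ => rfl, map_smul' := fun _ _ => rfl }
  have h1 := L.comp_hasDerivAt h
  have h2 : L (hamiltonian K R W * NormedSpace.exp (t • hamiltonian K R W)) =
      W * hamX K R W t + Kᵀ * hamY K R W t := by
    change toBlocks₂₁ _ = _
    unfold hamX hamY
    generalize NormedSpace.exp (t • hamiltonian K R W) = Z
    conv_lhs => rw [← fromBlocks_toBlocks Z, hamiltonian, fromBlocks_multiply]
    rw [toBlocks_fromBlocks₂₁]
  exact h1.congr_deriv h2

theorem hasDerivAt_hamX_mulVec (K R W : Matrix ι ι ℝ) (v : ι → ℝ) (t : ℝ) :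
    HasDerivAt (fun s => hamX K R W s *ᵥ v)
      (-(K *ᵥ (hamX K R W t *ᵥ v)) + R *ᵥ (hamY K R W t *ᵥ v)) t := by
  have h := hasDerivAt_mulVec (hasDerivAt_hamX K R W t) (hasDerivAt_const t v)
  rw [mulVec_zero, add_zero, add_mulVec, ← mulVec_mulVec, ← mulVec_mulVec, neg_mulVec] at h
  exact h

theorem hasDerivAt_hamY_mulVec (K R W : Matrix ι ι ℝ) (v : ι → ℝ) (t : ℝ) :
    HasDerivAt (fun s => hamY K R W s *ᵥ v)
      (W *ᵥ (hamX K R W t *ᵥ v) + Kᵀ *ᵥ (hamY K R W t *ᵥ v)) t := by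
  have h := hasDerivAt_mulVec (hasDerivAt_hamY K R W t) (hasDerivAt_const t v)
  rw [mulVec_zero, add_zero, add_mulVec, ← mulVec_mulVec, ← mulVec_mulVec] at h
  exact h

/-- The two `K` terms cancel, leaving only nonnegative terms when `R` and `W` are positive
semidefinite. This drives both the absence of conjugate points and the sign of the Riccati flow. -/
theorem hasDerivAt_hamX_dotProduct_hamY (K R W : Matrix ι ι ℝ) (v : ι → ℝ) (t : ℝ) :
    HasDerivAt (fun s => (hamX K R W s *ᵥ v) ⬝ᵥ (hamY K R W s *ᵥ v))
      ((hamY K R W t *ᵥ v) ⬝ᵥ (R *ᵥ (hamY K R W t *ᵥ v)) +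
        (hamX K R W t *ᵥ v) ⬝ᵥ (W *ᵥ (hamX K R W t *ᵥ v))) t := by
  have h := hasDerivAt_dotProduct (hasDerivAt_hamX_mulVec K R W v t)
    (hasDerivAt_hamY_mulVec K R W v t)
  convert h using 1
  generalize hamX K R W t *ᵥ v = x
  generalize hamY K R W t *ᵥ v = y
  rw [add_dotProduct, neg_dotProduct, dotProduct_add, mulVec_dotProduct_eq K,
    dotProduct_comm (R *ᵥ y)]
  ring

theorem monotone_hamX_dotProduct_hamY (hR : R.PosSemidef) (hW : W.PosSemidef) (v : ι → ℝ) :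
    Monotone (fun s => (hamX K R W s *ᵥ v) ⬝ᵥ (hamY K R W s *ᵥ v)) :=
  monotone_of_hasDerivAt_nonneg (hasDerivAt_hamX_dotProduct_hamY K R W v)
    fun _ => add_nonneg (hR.real_nonneg _) (hW.real_nonneg _)

/-- There are no conjugate points. If `X(T) v = 0`, the increasing pairing of `X v` and `Y v`
vanishes at both ends of `[0, T]`, hence throughout. Then its derivative vanishes, so `R Y v = 0`
and `X v` solves `x' = -K x` with `x(T) = 0`; thus `v = X(0) v = 0`. -/
theorem isUnit_hamX (hR : R.PosSemidef) (hW : W.PosSemidef) {T : ℝ} (hT : 0 ≤ T) :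
    IsUnit (hamX K R W T) := by
  have hker : ∀ v, hamX K R W T *ᵥ v = 0 → v = 0 := by
    intro v hv
    have hmono := monotone_hamX_dotProduct_hamY (K := K) hR hW v
    have hzero : ∀ s ∈ Icc 0 T, (hamX K R W s *ᵥ v) ⬝ᵥ (hamY K R W s *ᵥ v) = 0 := by
      intro s hs
      have h1 := hmono hs.1
      have h2 := hmono hs.2
      simp only [hamY_zero, zero_mulVec, dotProduct_zero, hv, zero_dotProduct] at h1 h2
      exact le_antisymm h2 h1
    have hRy : ∀ s ∈ Ioo 0 T, R *ᵥ (hamY K R W s *ᵥ v) = 0 := by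
      intro s hs
      have h1 := hasDerivAt_hamX_dotProduct_hamY K R W v s
      have h2 : (fun s => (hamX K R W s *ᵥ v) ⬝ᵥ (hamY K R W s *ᵥ v)) =ᶠ[𝓝 s] fun _ => 0 := by
        filter_upwards [Icc_mem_nhds hs.1 hs.2] with r hr using hzero r hr
      have h3 := h1.unique ((hasDerivAt_const s (0 : ℝ)).congr_of_eventuallyEq h2)
      have h4 := hR.real_nonneg (hamY K R W s *ᵥ v)
      have h5 := hW.real_nonneg (hamX K R W s *ᵥ v)
      have h6 : (hamY K R W s *ᵥ v) ⬝ᵥ (R *ᵥ (hamY K R W s *ᵥ v)) = 0 := by linarith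
      exact (hR.dotProduct_mulVec_zero_iff _).mp (by simpa using h6)
    -- Integrating factor `exp(s K)`: it makes the trajectory constant wherever `R Y v` vanishes.
    have hd : ∀ s, HasDerivAt (fun s : ℝ => NormedSpace.exp (s • K) *ᵥ (hamX K R W s *ᵥ v))
        (NormedSpace.exp (s • K) *ᵥ (R *ᵥ (hamY K R W s *ᵥ v))) s := by
      intro s
      have h := hasDerivAt_mulVec (hasDerivAt_exp_smul_const (𝕂 := ℝ) K s)
        (hasDerivAt_hamX_mulVec K R W v s)
      rw [mulVec_add, mulVec_neg, ← mulVec_mulVec, add_neg_cancel_left] at h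
      exact h
    rcases hT.eq_or_lt with rfl | hT0
    · simpa [hamX_zero] using hv
    have hconst : NormedSpace.exp (T • K) *ᵥ (hamX K R W T *ᵥ v) =
        NormedSpace.exp ((0 : ℝ) • K) *ᵥ (hamX K R W 0 *ᵥ v) := by
      funext i
      have hdi := fun s => (hasDerivAt_pi.mp (hd s)) i
      obtain ⟨c, hc, hc2⟩ := exists_hasDerivAt_eq_slope _ _ hT0
        (fun s _ => (hdi s).continuousAt.continuousWithinAt) (fun s _ => hdi s)
      rw [hRy c hc, mulVec_zero, Pi.zero_apply, eq_comm, div_eq_zero_iff] at hc2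
      rcases hc2 with h | h
      · exact sub_eq_zero.mp h
      · exact absurd h (by linarith)
    simpa [hv, hamX_zero] using hconst.symm
  rw [← mulVec_injective_iff_isUnit]
  intro x y hxy
  change hamX K R W T *ᵥ x = hamX K R W T *ᵥ y at hxy
  exact sub_eq_zero.mp (hker _ (by rw [mulVec_sub, hxy, sub_self]))

theorem hasDerivAt_riccatiFlow (hR : R.PosSemidef) (hW : W.PosSemidef) {t : ℝ} (ht : 0 ≤ t) :
    HasDerivAt (riccatiFlow K R W) (riccati K R W (riccatiFlow K R W t)) t := by
  have hu := isUnit_hamX (K := K) hR hW ht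
  have h := (hasDerivAt_hamY K R W t).mul (hasDerivAt_inv (hasDerivAt_hamX K R W t) hu)
  have hXX : hamX K R W t * (hamX K R W t)⁻¹ = 1 :=
    mul_nonsing_inv _ ((isUnit_iff_isUnit_det _).mp hu)
  have h2 : (W * hamX K R W t + Kᵀ * hamY K R W t) * (hamX K R W t)⁻¹ + hamY K R W t *
      -((hamX K R W t)⁻¹ * (-K * hamX K R W t + R * hamY K R W t) * (hamX K R W t)⁻¹) =
      riccati K R W (riccatiFlow K R W t) := by
    rw [riccati, riccatiFlow]
    generalize (hamX K R W t)⁻¹ = Z at *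
    generalize (hamX K R W t) = X at *
    generalize (hamY K R W t) = Y at *
    have e : (W * X + Kᵀ * Y) * Z + Y * -(Z * (-K * X + R * Y) * Z) =
      W * (X * Z) + Kᵀ * (Y * Z) + Y * Z * K * (X * Z) - Y * Z * R * (Y * Z) := by noncomm_ring
    rw [e, hXX]
    noncomm_ring
  rw [h2] at h
  exact h

/-- The Hamiltonian flow is symplectic and starts from a Lagrangian subspace; this becomes the
symmetry of `Y X⁻¹`. -/
theorem hamX_transpose_mul_hamY (hR : R.IsSymm) (hW : W.IsSymm) (t : ℝ) :
    (hamX K R W t)ᵀ * hamY K R W t = (hamY K R W t)ᵀ * hamX K R W t := by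
  have hd : ∀ s, HasDerivAt (fun s => (hamX K R W s)ᵀ * hamY K R W s -
      (hamY K R W s)ᵀ * hamX K R W s) 0 s := by
    intro s
    have hX := hasDerivAt_hamX K R W s
    have hY := hasDerivAt_hamY K R W s
    have h := ((hasDerivAt_transpose hX).mul hY).sub ((hasDerivAt_transpose hY).mul hX)
    refine h.congr_deriv ?_
    simp only [transpose_add, transpose_mul, transpose_neg, hR.eq, hW.eq, transpose_transpose]
    noncomm_ring
  have := is_const_of_deriv_eq_zero (fun s => (hd s).differentiableAt) (fun s => (hd s).deriv) t 0
  simp only [hamX_zero, hamY_zero] at this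
  simpa [sub_eq_zero] using this

/-- Conservation of energy along the flow. With `Y = Q X` it says that `Xᵀ Q' X` is constantly `W`,
so the Riccati flow is increasing. -/
theorem hamiltonian_conserved (hR : R.IsSymm) (hW : W.IsSymm) (t : ℝ) :
    (hamX K R W t)ᵀ * W * hamX K R W t + (hamX K R W t)ᵀ * Kᵀ * hamY K R W t +
      (hamY K R W t)ᵀ * K * hamX K R W t - (hamY K R W t)ᵀ * R * hamY K R W t = W := by
  have hd : ∀ s, HasDerivAt (fun s => (hamX K R W s)ᵀ * W * hamX K R W s +
      (hamX K R W s)ᵀ * Kᵀ * hamY K R W s +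
      (hamY K R W s)ᵀ * K * hamX K R W s - (hamY K R W s)ᵀ * R * hamY K R W s) 0 s := by
    intro s
    have hX := hasDerivAt_hamX K R W s
    have hY := hasDerivAt_hamY K R W s
    have hX' := hasDerivAt_transpose hX
    have hY' := hasDerivAt_transpose hY
    have h := ((((hX'.mul_const W).mul hX).add ((hX'.mul_const Kᵀ).mul hY)).add
      ((hY'.mul_const K).mul hX)).sub ((hY'.mul_const R).mul hY)
    refine h.congr_deriv ?_
    simp only [transpose_add, transpose_mul, transpose_neg, hR.eq, hW.eq, transpose_transpose]
    noncomm_ring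
  have := is_const_of_deriv_eq_zero (fun s => (hd s).differentiableAt) (fun s => (hd s).deriv) t 0
  simp only [hamX_zero, hamY_zero] at this
  simpa using this

end Calculus

end Matrix

/-- If a function and its derivative both converge at infinity, the derivative tends to zero. -/
theorem eq_zero_of_tendsto_hasDerivAt {f f' : ℝ → ℝ} {l l' : ℝ}
    (hd : ∀ t, 0 ≤ t → HasDerivAt f (f' t) t) (hf : Tendsto f atTop (𝓝 l))
    (hf' : Tendsto f' atTop (𝓝 l')) : l' = 0 := by
  have hslope : ∀ t : ℝ, ∃ c, t ≤ c ∧ (0 ≤ t → f' c = f (t + 1) - f t) := by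
    intro t
    by_cases ht : 0 ≤ t
    · obtain ⟨c, hc, h⟩ := exists_hasDerivAt_eq_slope f f' (lt_add_one t)
        (fun s hs => (hd s (ht.trans hs.1)).continuousAt.continuousWithinAt)
        (fun s hs => hd s (ht.trans hs.1.le))
      exact ⟨c, hc.1.le, fun _ => by simpa using h⟩
    · exact ⟨t, le_rfl, fun h => absurd h ht⟩
  choose c hc hcs using hslope
  have h1 := hf'.comp (tendsto_atTop_mono hc tendsto_id)
  have h2 : Tendsto (fun t => f (t + 1) - f t) atTop (𝓝 (l - l)) :=
    (hf.comp (tendsto_atTop_add_const_right _ 1 tendsto_id)).sub hf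
  rw [sub_self] at h2
  refine tendsto_nhds_unique h1 (h2.congr' ?_)
  filter_upwards [eventually_ge_atTop 0] with t ht using (hcs t ht).symm

/-! ### Convergence of the Riccati and affine flows, and stability of the closed loop. -/

namespace Matrix

/-- Detectability makes the closed loop of a positive semidefinite stationary solution stable. -/
theorem lyapunovStable_closedLoop {ι : Type*} [Fintype ι] {K R W G : Matrix ι ι ℝ}
    (hG : LyapunovStable G) {κ : ℝ} (hκ : 0 ≤ κ)
    (hdet : ∀ p x, ((K - G) *ᵥ x - R *ᵥ p) ⬝ᵥ ((K - G) *ᵥ x - R *ᵥ p) ≤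
      κ * (p ⬝ᵥ (R *ᵥ p) + x ⬝ᵥ (W *ᵥ x)))
    {Q : Matrix ι ι ℝ} (hQ : Q.IsSymm) (hQ0 : ∀ x, 0 ≤ x ⬝ᵥ (Q *ᵥ x))
    (hric : riccati K R W Q = 0) : LyapunovStable (K - R * Q) := by
  obtain ⟨L, c, hL, hc, hpos, hneg⟩ := hG
  obtain ⟨C, hC, hCL⟩ := exists_mulVec_dotProduct_self_le L
  have hε : 0 < c / C := by positivity
  have hM : 0 ≤ (c / C)⁻¹ * κ := by positivity
  -- The Riccati equation gives `Qx·(K - R Q)x = -½ (Qx·R Qx + x·W x)`. By detectability this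
  -- dissipation pays for replacing `G` by `K - R Q` in the form `L`; the factor of `Q` is chosen so
  -- that the two cancel exactly.
  refine ⟨L + ((c / C)⁻¹ * κ) • Q, c / 2, hL.add (hQ.smul _), by positivity, fun x => ?_,
    fun x => ?_⟩
  · rw [add_mulVec, dotProduct_add, smul_mulVec, dotProduct_smul, smul_eq_mul]
    have := hpos x
    have := mul_nonneg hM (hQ0 x)
    have := mul_nonneg hc.le (dotProduct_self_nonneg x)
    linarith
  · have h1 := dotProduct_riccati_mulVec (K := K) (R := R) (W := W) hQ x
    rw [hric, zero_mulVec, dotProduct_zero] at h1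
    have h2 := hneg x
    have h3 := two_mul_dotProduct_le hε (L *ᵥ x) ((K - G) *ᵥ x - R *ᵥ (Q *ᵥ x))
    have h4 : c / C * ((L *ᵥ x) ⬝ᵥ (L *ᵥ x)) ≤ c * (x ⬝ᵥ x) := by
      have := mul_le_mul_of_nonneg_left (hCL x) hε.le
      rwa [← mul_assoc, div_mul_cancel₀ _ hC.ne'] at this
    have h5 := mul_le_mul_of_nonneg_left (hdet (Q *ᵥ x) x) (inv_nonneg.mpr hε.le)
    rw [← mul_assoc] at h5
    have h6 : (L *ᵥ x) ⬝ᵥ ((K - G) *ᵥ x - R *ᵥ (Q *ᵥ x)) = (L *ᵥ x) ⬝ᵥ (K *ᵥ x) -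
        (L *ᵥ x) ⬝ᵥ (G *ᵥ x) - (L *ᵥ x) ⬝ᵥ (R *ᵥ (Q *ᵥ x)) := by
      rw [sub_mulVec, dotProduct_sub, dotProduct_sub]
    rw [h6] at h3
    rw [add_mulVec, add_dotProduct, smul_mulVec, smul_dotProduct, smul_eq_mul, sub_mulVec,
      dotProduct_sub, dotProduct_sub, ← mulVec_mulVec]
    generalize (c / C)⁻¹ * κ = M at *
    have h7 : M * ((Q *ᵥ x) ⬝ᵥ (K *ᵥ x) - (Q *ᵥ x) ⬝ᵥ (R *ᵥ (Q *ᵥ x))) =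
        -(M * ((Q *ᵥ x) ⬝ᵥ (R *ᵥ (Q *ᵥ x)) + x ⬝ᵥ (W *ᵥ x))) / 2 := by
      linear_combination (-M / 2) * h1
    linarith

variable {ι : Type*} [Fintype ι] [DecidableEq ι] {K R W G : Matrix ι ι ℝ}

theorem hamX_inv_mulVec (hR : R.PosSemidef) (hW : W.PosSemidef) {t : ℝ} (ht : 0 ≤ t) (x : ι → ℝ) :
    hamX K R W t *ᵥ ((hamX K R W t)⁻¹ *ᵥ x) = x := by
  rw [mulVec_mulVec, mul_nonsing_inv _ ((isUnit_iff_isUnit_det _).mp (isUnit_hamX hR hW ht)),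
    one_mulVec]

theorem riccatiFlow_mul_hamX (hR : R.PosSemidef) (hW : W.PosSemidef) {t : ℝ} (ht : 0 ≤ t) :
    riccatiFlow K R W t * hamX K R W t = hamY K R W t := by
  rw [riccatiFlow, mul_assoc, nonsing_inv_mul _
    ((isUnit_iff_isUnit_det _).mp (isUnit_hamX hR hW ht)), mul_one]

theorem riccatiFlow_zero : riccatiFlow K R W 0 = 0 := by
  rw [riccatiFlow, hamY_zero, zero_mul]

theorem isSymm_riccatiFlow (hR : R.PosSemidef) (hW : W.PosSemidef) {t : ℝ} (ht : 0 ≤ t) :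
    (riccatiFlow K R W t).IsSymm := by
  have hu := (isUnit_iff_isUnit_det _).mp (isUnit_hamX (K := K) hR hW ht)
  have h := hamX_transpose_mul_hamY (K := K) hR.real_isSymm hW.real_isSymm t
  rw [IsSymm, riccatiFlow, transpose_mul, transpose_nonsing_inv]
  calc ((hamX K R W t)ᵀ)⁻¹ * (hamY K R W t)ᵀ
      = ((hamX K R W t)ᵀ)⁻¹ * ((hamY K R W t)ᵀ * hamX K R W t) * (hamX K R W t)⁻¹ := by
        rw [mul_assoc, mul_assoc, mul_nonsing_inv _ hu, mul_one]
    _ = hamY K R W t * (hamX K R W t)⁻¹ := by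
        rw [← h, ← mul_assoc, nonsing_inv_mul _ (by rwa [det_transpose]), one_mul]

theorem riccatiFlow_nonneg (hR : R.PosSemidef) (hW : W.PosSemidef) {t : ℝ} (ht : 0 ≤ t)
    (x : ι → ℝ) : 0 ≤ x ⬝ᵥ (riccatiFlow K R W t *ᵥ x) := by
  rw [← hamX_inv_mulVec (K := K) hR hW ht x]
  generalize (hamX K R W t)⁻¹ *ᵥ x = v
  rw [mulVec_mulVec v (riccatiFlow K R W t), riccatiFlow_mul_hamX hR hW ht]
  have := monotone_hamX_dotProduct_hamY (K := K) hR hW v ht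
  simpa [hamY_zero] using this

theorem riccati_riccatiFlow_nonneg (hR : R.PosSemidef) (hW : W.PosSemidef) {t : ℝ} (ht : 0 ≤ t)
    (x : ι → ℝ) : 0 ≤ x ⬝ᵥ (riccati K R W (riccatiFlow K R W t) *ᵥ x) := by
  have hs := isSymm_riccatiFlow (K := K) hR hW ht
  have hXX := hamX_inv_mulVec (K := K) hR hW ht x
  have hQX := riccatiFlow_mul_hamX (K := K) hR hW ht
  have hXQ : (hamX K R W t)ᵀ * riccatiFlow K R W t = (hamY K R W t)ᵀ := by
    rw [← hQX, transpose_mul, hs.eq]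
  have hcons := hamiltonian_conserved (K := K) hR.real_isSymm hW.real_isSymm t
  rw [← hXX, mulVec_dotProduct_eq, mulVec_mulVec, mulVec_mulVec]
  have e : (hamX K R W t)ᵀ * riccati K R W (riccatiFlow K R W t) * hamX K R W t = W := by
    rw [riccati]
    generalize (hamX K R W t) = X at *
    generalize (hamY K R W t) = Y at *
    generalize (riccatiFlow K R W t) = Q at *
    have : Xᵀ * (Kᵀ * Q + Q * K - Q * R * Q + W) * X = Xᵀ * W * X + Xᵀ * Kᵀ * (Q * X) +
      (Xᵀ * Q) * K * X - (Xᵀ * Q) * R * (Q * X) := by noncomm_ring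
    rw [this, hQX, hXQ, hcons]
  rw [e]
  exact hW.real_nonneg _

theorem hasDerivAt_dotProduct_riccatiFlow (hR : R.PosSemidef) (hW : W.PosSemidef) {t : ℝ}
    (ht : 0 ≤ t) (x : ι → ℝ) : HasDerivAt (fun s => x ⬝ᵥ (riccatiFlow K R W s *ᵥ x))
      (x ⬝ᵥ (riccati K R W (riccatiFlow K R W t) *ᵥ x)) t := by
  have h := hasDerivAt_dotProduct (hasDerivAt_const t x)
    (hasDerivAt_mulVec (hasDerivAt_riccatiFlow (K := K) hR hW ht) (hasDerivAt_const t x))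
  refine h.congr_deriv ?_
  simp

theorem monotoneOn_riccatiFlow (hR : R.PosSemidef) (hW : W.PosSemidef) (x : ι → ℝ) :
    MonotoneOn (fun t => x ⬝ᵥ (riccatiFlow K R W t *ᵥ x)) (Ici 0) := by
  refine monotoneOn_of_hasDerivWithinAt_nonneg (convex_Ici 0)
    (fun t ht => (hasDerivAt_dotProduct_riccatiFlow hR hW ht x).continuousAt.continuousWithinAt)
    (fun t ht => (hasDerivAt_dotProduct_riccatiFlow hR hW
      (interior_subset ht) x).hasDerivWithinAt) fun t ht => ?_
  exact riccati_riccatiFlow_nonneg hR hW (interior_subset ht) x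

/-- Stabilizability of the control problem bounds the Riccati flow. -/
theorem riccatiFlow_bounded (hR : R.PosSemidef) (hW : W.PosSemidef) (hG : LyapunovStable G) {κ : ℝ}
    (hκ : 0 ≤ κ)
    (hstab : ∀ p x, 2 * (p ⬝ᵥ ((K - G) *ᵥ x)) ≤ p ⬝ᵥ (R *ᵥ p) + κ * (x ⬝ᵥ (W *ᵥ x))) (v : ι → ℝ) :
    ∃ C, ∀ t, 0 ≤ t → v ⬝ᵥ (riccatiFlow K R W t *ᵥ v) ≤ C := by
  obtain ⟨L, c, hL, hc, hpos, hneg⟩ := hG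
  obtain ⟨C₀, hC₀, hCW⟩ := exists_abs_dotProduct_mulVec_le W
  -- Chosen so that the decay `2 M c |u|²` of `M • L` along `G` equals the bound `(1 + κ) C₀ |u|²`
  -- on the running cost.
  set M := (1 + κ) * C₀ / (2 * c) with hM
  have hM0 : 0 ≤ M := by positivity
  refine ⟨v ⬝ᵥ ((M • L) *ᵥ v), fun T hT => ?_⟩
  set w := NormedSpace.exp (T • G) *ᵥ v
  -- The trajectory of `G` in reversed time, ending at `v` at time `T`. Along it the gap between the
  -- forms of `M • L` and of the flow is nondecreasing, and it is nonnegative at time 0.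
  set u : ℝ → ι → ℝ := fun s => NormedSpace.exp (s • (-G)) *ᵥ w with hu_def
  have hu : ∀ s, HasDerivAt u (-(G *ᵥ u s)) s := fun s =>
    (hasDerivAt_exp_smul_mulVec (-G) w s).congr_deriv (neg_mulVec _ _)
  have huT : u T = v := by
    have h1 : NormedSpace.exp (T • (-G)) * NormedSpace.exp (T • G) = 1 := by
      rw [smul_neg, Matrix.exp_neg]
      exact nonsing_inv_mul _ ((isUnit_iff_isUnit_det _).mp (Matrix.isUnit_exp _))
    simp only [hu_def, w]
    rw [mulVec_mulVec, h1, one_mulVec]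
  have hd : ∀ s, 0 ≤ s → HasDerivAt
      (fun s => u s ⬝ᵥ ((M • L) *ᵥ u s) - u s ⬝ᵥ (riccatiFlow K R W s *ᵥ u s))
      (-2 * M * ((L *ᵥ u s) ⬝ᵥ (G *ᵥ u s)) + 2 * ((riccatiFlow K R W s *ᵥ u s) ⬝ᵥ (G *ᵥ u s)) -
        u s ⬝ᵥ (riccati K R W (riccatiFlow K R W s) *ᵥ u s)) s := by
    intro s hs
    have h1 := hasDerivAt_dotProduct (hu s) (hasDerivAt_const_mulVec (M • L) (hu s))
    have h2 := hasDerivAt_dotProduct (hu s)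
      (hasDerivAt_mulVec (hasDerivAt_riccatiFlow (K := K) hR hW hs) (hu s))
    refine (h1.sub h2).congr_deriv ?_
    have hQ := isSymm_riccatiFlow (K := K) hR hW hs
    generalize riccatiFlow K R W s = Q at *
    generalize u s = x at *
    rw [mulVec_neg, mulVec_neg, dotProduct_add, neg_dotProduct, neg_dotProduct, dotProduct_neg,
      dotProduct_neg, dotProduct_mulVec_comm hQ x, smul_mulVec, smul_mulVec, dotProduct_smul,
      dotProduct_smul, dotProduct_mulVec_comm hL x, smul_eq_mul, dotProduct_comm (L *ᵥ x),
      dotProduct_comm (Q *ᵥ x)]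
    ring
  have hmono : MonotoneOn
      (fun s => u s ⬝ᵥ ((M • L) *ᵥ u s) - u s ⬝ᵥ (riccatiFlow K R W s *ᵥ u s)) (Ici 0) := by
    refine monotoneOn_of_hasDerivWithinAt_nonneg (convex_Ici 0)
      (fun s hs => (hd s hs).continuousAt.continuousWithinAt)
      (fun s hs => (hd s (interior_subset hs)).hasDerivWithinAt) fun s hs => ?_
    have hQ := isSymm_riccatiFlow (K := K) hR hW (interior_subset hs)
    rw [dotProduct_riccati_mulVec hQ]
    generalize riccatiFlow K R W s = Q at *
    generalize u s = x at *
    have h1 := hstab (Q *ᵥ x) x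
    rw [sub_mulVec, dotProduct_sub] at h1
    have h2 := mul_le_mul_of_nonneg_left (hneg x) hM0
    have h3 := (le_abs_self _).trans (hCW x)
    have h4 := mul_le_mul_of_nonneg_left h3 (show 0 ≤ 1 + κ by linarith)
    have h5 : M * (-c * (x ⬝ᵥ x)) * 2 = -((1 + κ) * (C₀ * (x ⬝ᵥ x))) := by
      rw [hM]; field_simp
    linarith
  have h := hmono (mem_Ici.mpr le_rfl) (mem_Ici.mpr hT) hT
  simp only [riccatiFlow_zero, zero_mulVec, dotProduct_zero, sub_zero, huT] at h
  have h0 : 0 ≤ u 0 ⬝ᵥ ((M • L) *ᵥ u 0) := by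
    rw [smul_mulVec, dotProduct_smul]
    exact mul_nonneg hM0 ((mul_nonneg hc.le (dotProduct_self_nonneg _)).trans (hpos _))
  linarith

/-- Under stabilizability the Riccati flow converges to a positive semidefinite solution of the
algebraic Riccati equation. -/
theorem exists_tendsto_riccatiFlow (hR : R.PosSemidef) (hW : W.PosSemidef) (hG : LyapunovStable G)
    {κ : ℝ} (hκ : 0 ≤ κ)
    (hstab : ∀ p x, 2 * (p ⬝ᵥ ((K - G) *ᵥ x)) ≤ p ⬝ᵥ (R *ᵥ p) + κ * (x ⬝ᵥ (W *ᵥ x))) :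
    ∃ Q : Matrix ι ι ℝ, Q.IsSymm ∧ (∀ x, 0 ≤ x ⬝ᵥ (Q *ᵥ x)) ∧ riccati K R W Q = 0 ∧
      Tendsto (riccatiFlow K R W) atTop (𝓝 Q) := by
  have hform : ∀ x : ι → ℝ, ∃ l, Tendsto (fun t => x ⬝ᵥ (riccatiFlow K R W t *ᵥ x)) atTop (𝓝 l) := by
    intro x
    obtain ⟨C, hC⟩ := riccatiFlow_bounded hR hW hG hκ hstab x
    -- Monotonicity is known only for nonnegative times, hence the truncation by `max t 0`.
    have hmono : Monotone fun t => x ⬝ᵥ (riccatiFlow K R W (max t 0) *ᵥ x) := fun s t hst =>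
      monotoneOn_riccatiFlow hR hW x (le_max_right s 0) (le_max_right t 0)
        (max_le_max_right 0 hst)
    have hb : BddAbove (range fun t => x ⬝ᵥ (riccatiFlow K R W (max t 0) *ᵥ x)) :=
      ⟨C, by rintro _ ⟨t, rfl⟩; exact hC _ (le_max_right t 0)⟩
    refine ⟨_, (tendsto_atTop_ciSup hmono hb).congr' ?_⟩
    filter_upwards [eventually_ge_atTop 0] with t ht
    rw [max_eq_left ht]
  choose l hl using hform
  -- The limit matrix is recovered from the limits of the quadratic form by polarisation.
  set Q : Matrix ι ι ℝ := fun i j => (l (Pi.single i 1 + Pi.single j 1) - l (Pi.single i 1) -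
    l (Pi.single j 1)) / 2
  have hQ : Tendsto (riccatiFlow K R W) atTop (𝓝 Q) := by
    refine tendsto_pi_nhds.mpr fun i => tendsto_pi_nhds.mpr fun j => ?_
    refine ((((hl _).sub (hl _)).sub (hl _)).div_const 2).congr' ?_
    filter_upwards [eventually_ge_atTop 0] with t ht
    exact ((isSymm_riccatiFlow (K := K) hR hW ht).apply_eq i j).symm
  refine ⟨Q, ?_, fun x => ?_, ?_, hQ⟩
  · have h1 : Tendsto (fun t => (riccatiFlow K R W t)ᵀ) atTop (𝓝 Qᵀ) :=
      ((continuous_id.matrix_transpose).tendsto Q).comp hQ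
    refine tendsto_nhds_unique h1 (hQ.congr' ?_)
    filter_upwards [eventually_ge_atTop 0] with t ht
    exact (isSymm_riccatiFlow (K := K) hR hW ht).eq.symm
  · have hc : Continuous fun A : Matrix ι ι ℝ => x ⬝ᵥ (A *ᵥ x) := by fun_prop
    refine ge_of_tendsto ((hc.tendsto Q).comp hQ) ?_
    filter_upwards [eventually_ge_atTop 0] with t ht
    exact riccatiFlow_nonneg hR hW ht x
  · have hc : Continuous fun A : Matrix ι ι ℝ => riccati K R W A := by
      unfold riccati
      fun_prop
    have hric := (hc.tendsto Q).comp hQ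
    ext i j
    exact eq_zero_of_tendsto_hasDerivAt
      (fun t ht => hasDerivAt_apply (hasDerivAt_riccatiFlow (K := K) hR hW ht) i j)
      ((hQ.apply_nhds i).apply_nhds j) ((hric.apply_nhds i).apply_nhds j)

/-- The solution of `q' = (K - R Q)ᵀ q + g - Q f`, `q(0) = 0`, along the Riccati flow `Q`. -/
def affineFlow (K R W : Matrix ι ι ℝ) (f g : ι → ℝ) (t : ℝ) : ι → ℝ :=
  ((hamX K R W t)ᵀ)⁻¹ *ᵥ ∫ s in (0 : ℝ)..t, ((hamX K R W s)ᵀ *ᵥ g - (hamY K R W s)ᵀ *ᵥ f)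

theorem affineFlow_zero (f g : ι → ℝ) : affineFlow K R W f g 0 = 0 := by
  simp [affineFlow]

section Calculus

attribute [local instance] Matrix.linftyOpNormedAddCommGroup Matrix.linftyOpNormedSpace
  Matrix.linftyOpNormedRing Matrix.linftyOpNormedAlgebra

/-- Variation of constants: `X' = -(K - R Q) X`, so `(Xᵀ)⁻¹` is the fundamental solution of the
homogeneous equation, and the integrand is `Xᵀ (g - Q f)`. -/
theorem hasDerivAt_affineFlow (hR : R.PosSemidef) (hW : W.PosSemidef) (f g : ι → ℝ) {t : ℝ}
    (ht : 0 ≤ t) : HasDerivAt (affineFlow K R W f g)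
      ((K - R * riccatiFlow K R W t)ᵀ *ᵥ affineFlow K R W f g t + g -
        riccatiFlow K R W t *ᵥ f) t := by
  have hXc : Continuous (hamX K R W) :=
    continuous_iff_continuousAt.mpr fun s => (hasDerivAt_hamX K R W s).continuousAt
  have hYc : Continuous (hamY K R W) :=
    continuous_iff_continuousAt.mpr fun s => (hasDerivAt_hamY K R W s).continuousAt
  have hc : Continuous fun s => (hamX K R W s)ᵀ *ᵥ g - (hamY K R W s)ᵀ *ᵥ f := by fun_prop
  have hu := isUnit_hamX (K := K) hR hW ht
  have hut : IsUnit (hamX K R W t)ᵀ := by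
    rw [isUnit_iff_isUnit_det, det_transpose]
    exact (isUnit_iff_isUnit_det _).mp hu
  have hXX : ((hamX K R W t)ᵀ)⁻¹ * (hamX K R W t)ᵀ = 1 :=
    nonsing_inv_mul _ ((isUnit_iff_isUnit_det _).mp hut)
  have h1 := hasDerivAt_inv (hasDerivAt_transpose (hasDerivAt_hamX K R W t)) hut
  have h2 := hasDerivAt_mulVec h1 (hc.integral_hasStrictDerivAt 0 t).hasDerivAt
  refine h2.congr_deriv ?_
  have hQX := riccatiFlow_mul_hamX (K := K) hR hW ht
  have hQ := isSymm_riccatiFlow (K := K) hR hW ht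
  rw [affineFlow]
  generalize (∫ s in (0 : ℝ)..t, ((hamX K R W s)ᵀ *ᵥ g - (hamY K R W s)ᵀ *ᵥ f)) = z
  rw [← hQX]
  generalize hamX K R W t = X at *
  generalize riccatiFlow K R W t = Q at *
  have e1 : -((Xᵀ)⁻¹ * (-K * X + R * (Q * X))ᵀ * (Xᵀ)⁻¹) = (K - R * Q)ᵀ * (Xᵀ)⁻¹ := by
    have : (-K * X + R * (Q * X))ᵀ = -(Xᵀ * (K - R * Q)ᵀ) := by
      rw [← transpose_mul, ← transpose_neg]
      congr 1
      noncomm_ring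
    rw [this, mul_neg, neg_mul, neg_neg, ← mul_assoc, hXX, one_mul]
  rw [e1, mulVec_sub, mulVec_mulVec, mulVec_mulVec, mulVec_mulVec, transpose_mul, ← mul_assoc, hXX,
    one_mul, hQ.eq, one_mulVec, add_sub_assoc]

/-- Along a Riccati flow with stable limiting closed loop, the affine flow converges to the
stationary solution. -/
theorem tendsto_affineFlow (hR : R.PosSemidef) (hW : W.PosSemidef) {Q : Matrix ι ι ℝ}
    (hQ : Tendsto (riccatiFlow K R W) atTop (𝓝 Q)) (hF : LyapunovStable (K - R * Q))
    {f g q : ι → ℝ} (hq : (K - R * Q)ᵀ *ᵥ q + g - Q *ᵥ f = 0) :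
    Tendsto (affineFlow K R W f g) atTop (𝓝 q) := by
  have hA : Tendsto (fun t => (K - R * riccatiFlow K R W t)ᵀ) atTop (𝓝 (K - R * Q)ᵀ) := by
    have hc : Continuous fun A : Matrix ι ι ℝ => (K - R * A)ᵀ := by fun_prop
    exact (hc.tendsto Q).comp hQ
  have hh : Tendsto (fun t => (K - R * riccatiFlow K R W t)ᵀ *ᵥ q + g - riccatiFlow K R W t *ᵥ f)
      atTop (𝓝 0) := by
    have hc : Continuous fun A : Matrix ι ι ℝ => (K - R * A)ᵀ *ᵥ q + g - A *ᵥ f := by fun_prop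
    have := (hc.tendsto Q).comp hQ
    rwa [hq] at this
  -- The error solves a linear equation whose coefficient tends to the stable `(K - R Q)ᵀ`; its
  -- forcing is the residual of `q` in the time-dependent equation, which tends to zero.
  have h := hF.transpose.tendsto_zero (e := fun t => affineFlow K R W f g t - q) (fun t ht => ?_)
    hA hh
  · simpa using h.add_const q
  · refine ((hasDerivAt_affineFlow hR hW f g ht).sub_const q).congr_deriv ?_
    rw [mulVec_sub]
    abel

end Calculus

end Matrix

/-- Backward uniqueness for differential inequalities `‖f'‖ ≤ k ‖f‖` with zero terminal value. -/
theorem eqOn_zero_of_terminal {E : Type*} [NormedAddCommGroup E] [NormedSpace ℝ E] {f f' : ℝ → E}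
    {T k : ℝ} (hd : ∀ t ∈ Icc 0 T, HasDerivWithinAt f (f' t) (Icc 0 T) t) (hT : f T = 0)
    (hk : ∀ t ∈ Icc 0 T, ‖f' t‖ ≤ k * ‖f t‖) : ∀ t ∈ Icc 0 T, f t = 0 := by
  have hmaps : MapsTo (fun s : ℝ => T - s) (Icc 0 T) (Icc 0 T) := fun s hs =>
    ⟨by linarith [hs.2], by linarith [hs.1]⟩
  have hd' : ∀ s ∈ Icc 0 T, HasDerivWithinAt (fun s => f (T - s)) (-(f' (T - s))) (Icc 0 T) s := by
    intro s hs
    have h1 : HasDerivWithinAt (fun s : ℝ => T - s) (-1) (Icc 0 T) s :=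
      ((hasDerivAt_id s).const_sub T).hasDerivWithinAt
    exact ((hd (T - s) (hmaps hs)).scomp s h1 hmaps).congr_deriv (by simp)
  intro t ht
  have h := eq_zero_of_abs_deriv_le_mul_abs_self_of_eq_zero_right (f := fun s => f (T - s))
    (f' := fun s => -(f' (T - s))) (K := k) (a := 0) (b := T)
    (fun s hs => (hd' s hs).continuousWithinAt)
    (fun s hs => (hd' s (Ico_subset_Icc_self hs)).mono_of_mem_nhdsWithin
      (mem_of_superset (Icc_mem_nhdsGE hs.2) (Icc_subset_Icc_left hs.1)))
    (by simpa using hT)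
    (fun s hs => by rw [norm_neg]; exact hk _ (hmaps (Ico_subset_Icc_self hs)))
    (T - t) (hmaps ht)
  simpa using h

/-! ### The factor model as a linear-quadratic regulator. -/

namespace FactorModel

open Matrix

variable {m n : ℕ} (M : FactorModel m n)

/-- The stock covariance projection `Σ* (Σ Σ*)⁻¹ Σ`. -/
def proj : Matrix (Fin (n + m)) (Fin (n + m)) ℝ := M.volᵀ * M.covInv * M.vol

/-- The factor loading `Σ* (Σ Σ*)⁻¹ A`. -/
def load : Matrix (Fin (n + m)) (Fin n) ℝ := M.volᵀ * M.covInv * M.A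

/-- The quadratic coefficient `Λ N⁻¹ Λ*` of the Riccati equation. -/
def quad (γ : ℝ) : Matrix (Fin n) (Fin n) ℝ := M.lam * M.NInv γ * M.lamᵀ

/-- The constant coefficient `C* C` of the Riccati equation. -/
def cost (γ : ℝ) : Matrix (Fin n) (Fin n) ℝ := (M.C γ)ᵀ * M.C γ

/-- The vector multiplying the Riccati solution in the linear equation. -/
def drift (γ : ℝ) : Fin n → ℝ :=
  M.b + (γ / (1 - γ)) • ((M.lam * M.volᵀ * M.covInv) *ᵥ M.excess)

/-- The constant term of the linear equation. -/
def forcing (γ : ℝ) : Fin n → ℝ := (γ / (1 - γ)) • ((M.Aᵀ * M.covInv) *ᵥ M.excess)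

theorem ratio_neg {γ : ℝ} (hγ : γ < 0) : γ / (1 - γ) < 0 :=
  div_neg_of_neg_of_pos hγ (by linarith)

theorem one_add_ratio_pos {γ : ℝ} (hγ : γ < 0) : 0 < 1 + γ / (1 - γ) := by
  have h : 1 - γ ≠ 0 := by linarith
  have : 1 + γ / (1 - γ) = 1 / (1 - γ) := by
    field_simp
    ring
  rw [this]
  exact one_div_pos.mpr (by linarith)

variable {M}

theorem A1.mul_covInv (h1 : M.A1) : M.vol * M.volᵀ * M.covInv = 1 :=
  mul_nonsing_inv _ ((isUnit_iff_isUnit_det _).mp h1.isUnit)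

theorem covInv_isSymm : M.covInv.IsSymm := by
  rw [IsSymm, covInv, transpose_nonsing_inv, transpose_mul, transpose_transpose]

theorem A1.covInv_mul (h1 : M.A1) : M.covInv * (M.vol * M.volᵀ) = 1 :=
  nonsing_inv_mul _ ((isUnit_iff_isUnit_det _).mp h1.isUnit)

theorem proj_isSymm : M.proj.IsSymm := by
  rw [IsSymm, proj, transpose_mul, transpose_mul, covInv_isSymm.eq, transpose_transpose,
    Matrix.mul_assoc]

theorem A1.proj_mul_vol (h1 : M.A1) : M.proj * M.volᵀ = M.volᵀ := by
  rw [proj, Matrix.mul_assoc, Matrix.mul_assoc, h1.covInv_mul, Matrix.mul_one]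

theorem A1.proj_mul_proj (h1 : M.A1) : M.proj * M.proj = M.proj := by
  have := h1.proj_mul_vol
  calc M.proj * M.proj = M.proj * M.volᵀ * (M.covInv * M.vol) := by
        simp only [proj, Matrix.mul_assoc]
    _ = M.proj := by rw [this, proj, Matrix.mul_assoc]

theorem A1.dotProduct_proj (h1 : M.A1) (y : Fin (n + m) → ℝ) :
    (M.proj *ᵥ y) ⬝ᵥ (M.proj *ᵥ y) = y ⬝ᵥ (M.proj *ᵥ y) := by
  rw [mulVec_dotProduct_eq, proj_isSymm.eq, mulVec_mulVec, h1.proj_mul_proj]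

theorem A1.proj_le (h1 : M.A1) (y : Fin (n + m) → ℝ) : y ⬝ᵥ (M.proj *ᵥ y) ≤ y ⬝ᵥ y := by
  have h := dotProduct_self_nonneg (y - M.proj *ᵥ y)
  rw [sub_dotProduct, dotProduct_sub, dotProduct_sub, h1.dotProduct_proj,
    dotProduct_comm (M.proj *ᵥ y) y] at h
  linarith

theorem A1.proj_nonneg (h1 : M.A1) (y : Fin (n + m) → ℝ) : 0 ≤ y ⬝ᵥ (M.proj *ᵥ y) := by
  rw [← h1.dotProduct_proj]
  exact dotProduct_self_nonneg _

theorem NInv_mulVec (γ : ℝ) (y : Fin (n + m) → ℝ) :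
    M.NInv γ *ᵥ y = y + (γ / (1 - γ)) • (M.proj *ᵥ y) := by
  rw [NInv, add_mulVec, one_mulVec, smul_mulVec, proj]

theorem cost_eq {γ : ℝ} (hγ : γ < 0) : M.cost γ = (-(γ / (1 - γ))) • (M.loadᵀ * M.load) := by
  have h : C M γ = Real.sqrt (-(γ / (1 - γ))) • M.load := rfl
  rw [cost, h, transpose_smul, Matrix.smul_mul, Matrix.mul_smul, smul_smul,
    Real.mul_self_sqrt (by linarith [ratio_neg hγ])]

theorem dotProduct_cost {γ : ℝ} (hγ : γ < 0) (x : Fin n → ℝ) :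
    x ⬝ᵥ (M.cost γ *ᵥ x) = -(γ / (1 - γ)) * ((M.load *ᵥ x) ⬝ᵥ (M.load *ᵥ x)) := by
  rw [cost_eq hγ, smul_mulVec, dotProduct_smul, ← mulVec_mulVec, mulVec_dotProduct_eq, smul_eq_mul]

theorem cost_posSemidef (γ : ℝ) : (M.cost γ).PosSemidef := by
  have := posSemidef_conjTranspose_mul_self (M.C γ)
  rwa [conjTranspose_eq_transpose_of_trivial] at this

theorem dotProduct_quad (γ : ℝ) (p : Fin n → ℝ) :
    p ⬝ᵥ (M.quad γ *ᵥ p) = (M.lamᵀ *ᵥ p) ⬝ᵥ (M.NInv γ *ᵥ (M.lamᵀ *ᵥ p)) := by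
  rw [quad, ← mulVec_mulVec, ← mulVec_mulVec, mulVec_dotProduct_eq, transpose_transpose]

theorem dotProduct_NInv (γ : ℝ) (y : Fin (n + m) → ℝ) :
    y ⬝ᵥ (M.NInv γ *ᵥ y) = y ⬝ᵥ y + γ / (1 - γ) * (y ⬝ᵥ (M.proj *ᵥ y)) := by
  rw [NInv_mulVec, dotProduct_add, dotProduct_smul, smul_eq_mul]

theorem NInv_isSymm (γ : ℝ) : (M.NInv γ).IsSymm :=
  isSymm_one.add (proj_isSymm.smul _)

theorem quad_isSymm (γ : ℝ) : (M.quad γ).IsSymm := by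
  rw [IsSymm, quad, transpose_mul, transpose_mul, (NInv_isSymm γ).eq, transpose_transpose,
    Matrix.mul_assoc]

theorem A1.NInv_ge (h1 : M.A1) {γ : ℝ} (hγ : γ < 0) (y : Fin (n + m) → ℝ) :
    (1 + γ / (1 - γ)) * (y ⬝ᵥ y) ≤ y ⬝ᵥ (M.NInv γ *ᵥ y) := by
  rw [dotProduct_NInv]
  have := mul_le_mul_of_nonpos_left (h1.proj_le y) (ratio_neg hγ).le
  linarith

theorem A1.quad_posSemidef (h1 : M.A1) {γ : ℝ} (hγ : γ < 0) : (M.quad γ).PosSemidef := by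
  refine PosSemidef.of_dotProduct_mulVec_nonneg ?_ fun p => ?_
  · rw [IsHermitian, conjTranspose_eq_transpose_of_trivial]
    exact quad_isSymm γ
  · rw [star_trivial, dotProduct_quad]
    exact (mul_nonneg (one_add_ratio_pos hγ).le (dotProduct_self_nonneg _)).trans
      (h1.NInv_ge hγ _)

/-- The matrix that assumption (A2) requires to be stable. -/
def openLoop (M : FactorModel m n) : Matrix (Fin n) (Fin n) ℝ :=
  M.B - M.lam * M.volᵀ * M.covInv * M.A

theorem K1_sub_openLoop_mulVec (γ : ℝ) (x : Fin n → ℝ) :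
    (M.K1 γ - M.openLoop) *ᵥ x = (1 + γ / (1 - γ)) • (M.lam *ᵥ (M.load *ᵥ x)) := by
  have : M.K1 γ - M.openLoop = (1 + γ / (1 - γ)) • (M.lam * M.load) := by
    rw [K1, openLoop, load, add_smul, one_smul, ← Matrix.mul_assoc, ← Matrix.mul_assoc]
    abel
  rw [this, smul_mulVec, mulVec_mulVec]

/-- The difference `K₁ - G` factors as `(1 + τ) Λ D` with `D` the load. Young's inequality splits
the pairing into `(1 + τ) |Λᵀ p|²`, controlled by `N⁻¹ ≥ 1 + τ`, and `(1 + τ) |D x|²`, a multiple of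
the cost. -/
theorem A1.stabilizable (h1 : M.A1) {γ : ℝ} (hγ : γ < 0) (p x : Fin n → ℝ) :
    2 * (p ⬝ᵥ ((M.K1 γ - M.openLoop) *ᵥ x)) ≤ p ⬝ᵥ (M.quad γ *ᵥ p) +
      (1 + γ / (1 - γ)) / (-(γ / (1 - γ))) * (x ⬝ᵥ (M.cost γ *ᵥ x)) := by
  have hτ := ratio_neg hγ
  have hτ1 := one_add_ratio_pos hγ
  rw [K1_sub_openLoop_mulVec, dotProduct_smul, dotProduct_mulVec_eq, dotProduct_quad,
    dotProduct_cost hγ, smul_eq_mul]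
  have e := h1.NInv_ge hγ (M.lamᵀ *ᵥ p)
  have e2 := mul_le_mul_of_nonneg_left
    (two_mul_dotProduct_le one_pos (M.lamᵀ *ᵥ p) (M.load *ᵥ x)) hτ1.le
  have e3 : (1 + γ / (1 - γ)) / (-(γ / (1 - γ))) * (-(γ / (1 - γ)) * ((M.load *ᵥ x) ⬝ᵥ
      (M.load *ᵥ x))) = (1 + γ / (1 - γ)) * ((M.load *ᵥ x) ⬝ᵥ (M.load *ᵥ x)) := by
    rw [← mul_assoc, div_mul_cancel₀ _ (by linarith)]
  linarith

/-- The vector equals `Λ ((1 + τ) D x - N⁻¹ Λᵀ p)`. Since `N⁻¹` acts as `1 + τ` on the range of the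
projection and as 1 on its complement, its square is at most itself; so both pieces are controlled
by the running cost. -/
theorem A1.detectable (h1 : M.A1) {γ : ℝ} (hγ : γ < 0) : ∃ κ : ℝ, 0 ≤ κ ∧ ∀ p x : Fin n → ℝ,
    ((M.K1 γ - M.openLoop) *ᵥ x - M.quad γ *ᵥ p) ⬝ᵥ ((M.K1 γ - M.openLoop) *ᵥ x - M.quad γ *ᵥ p) ≤
      κ * (p ⬝ᵥ (M.quad γ *ᵥ p) + x ⬝ᵥ (M.cost γ *ᵥ x)) := by
  obtain ⟨c, hc, hcl⟩ := exists_mulVec_dotProduct_self_le M.lam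
  have hτ := ratio_neg hγ
  have hτ1 := one_add_ratio_pos hγ
  refine ⟨c * (2 * (1 + 1 / (-(γ / (1 - γ))))), ?_, fun p x => ?_⟩
  · have : 0 < 1 / (-(γ / (1 - γ))) := one_div_pos.mpr (by linarith)
    positivity
  have e : (M.K1 γ - M.openLoop) *ᵥ x - M.quad γ *ᵥ p =
      M.lam *ᵥ ((1 + γ / (1 - γ)) • (M.load *ᵥ x) - M.NInv γ *ᵥ (M.lamᵀ *ᵥ p)) := by
    rw [K1_sub_openLoop_mulVec, mulVec_sub, mulVec_smul, quad, ← mulVec_mulVec, ← mulVec_mulVec]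
  rw [e, dotProduct_quad, dotProduct_cost hγ, mul_assoc]
  refine (hcl _).trans (mul_le_mul_of_nonneg_left ?_ hc.le)
  generalize M.lamᵀ *ᵥ p = y
  generalize M.load *ᵥ x = d
  have hN : (M.NInv γ *ᵥ y) ⬝ᵥ (M.NInv γ *ᵥ y) ≤ y ⬝ᵥ (M.NInv γ *ᵥ y) := by
    rw [dotProduct_NInv, NInv_mulVec, add_dotProduct, dotProduct_add, dotProduct_add,
      smul_dotProduct, smul_dotProduct, dotProduct_smul, dotProduct_smul, h1.dotProduct_proj,
      dotProduct_comm (M.proj *ᵥ y) y]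
    simp only [smul_eq_mul]
    have := h1.proj_nonneg y
    have h3 : γ / (1 - γ) * (1 + γ / (1 - γ)) ≤ 0 := mul_nonpos_of_nonpos_of_nonneg hτ.le hτ1.le
    have := mul_nonpos_of_nonpos_of_nonneg h3 this
    linarith
  have hN0 := (mul_nonneg hτ1.le (dotProduct_self_nonneg y)).trans (h1.NInv_ge hγ y)
  generalize M.NInv γ *ᵥ y = z at *
  generalize γ / (1 - γ) = τ at *
  -- This yields `|(1 + τ) d - z|² ≤ 2 |(1 + τ) d|² + 2 |z|²`.
  have h2 := dotProduct_self_nonneg ((1 + τ) • d + z)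
  have hd := dotProduct_self_nonneg d
  simp only [sub_dotProduct, add_dotProduct, dotProduct_sub, dotProduct_add, smul_dotProduct,
    dotProduct_smul, smul_eq_mul] at h2 ⊢
  have h4 : (1 + τ) * ((1 + τ) * (d ⬝ᵥ d)) ≤ d ⬝ᵥ d := by
    have h3 : (1 + τ) * (1 + τ) ≤ 1 := by nlinarith
    have := mul_le_mul_of_nonneg_right h3 hd
    linarith
  have h5 : 2 * (1 + 1 / (-τ)) * (y ⬝ᵥ z + -τ * (d ⬝ᵥ d)) =
      2 * (y ⬝ᵥ z) + 2 * (d ⬝ᵥ d) + (2 * (1 / (-τ)) * (y ⬝ᵥ z) + 2 * (-τ) * (d ⬝ᵥ d)) := by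
    have : τ ≠ 0 := hτ.ne
    field_simp
    ring
  have h6 : 0 ≤ 2 * (1 / (-τ)) * (y ⬝ᵥ z) + 2 * (-τ) * (d ⬝ᵥ d) := by
    have : 0 < 1 / (-τ) := one_div_pos.mpr (by linarith)
    have := mul_nonneg this.le hN0
    have := mul_nonneg (show 0 ≤ -τ by linarith) hd
    linarith
  rw [h5]
  linarith

/-- The sign change `Q = -P` brings the equation to regulator form, with nonnegative cost. -/
theorem riccatiOp_eq (γ : ℝ) (X : Matrix (Fin n) (Fin n) ℝ) :
    M.riccatiOp γ X = -riccati (M.K1 γ) (M.quad γ) (M.cost γ) (-X) := by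
  rw [riccatiOp, riccati, quad, cost]
  simp only [Matrix.mul_assoc, Matrix.mul_neg, Matrix.neg_mul, neg_neg]
  abel

theorem linearOp_eq (γ : ℝ) (X : Matrix (Fin n) (Fin n) ℝ) (x : Fin n → ℝ) :
    M.linearOp γ X x = (M.K1 γ + M.quad γ * X)ᵀ *ᵥ x + M.forcing γ + X *ᵥ M.drift γ := by
  rw [linearOp, quad, forcing, drift, mulVec_add, mulVec_smul, Matrix.add_mul, add_mulVec,
    mulVec_mulVec, smul_add]
  simp only [Matrix.mul_assoc]
  abel

/-! ### Uniqueness and existence of the stationary data. -/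

section Uniqueness

attribute [local instance] Matrix.linftyOpNormedAddCommGroup Matrix.linftyOpNormedSpace
  Matrix.linftyOpNormedRing Matrix.linftyOpNormedAlgebra

theorem SolvesRiccatiODE.hasDerivWithinAt {γ T : ℝ} {P : ℝ → Matrix (Fin n) (Fin n) ℝ}
    (h : M.SolvesRiccatiODE γ T P) {t : ℝ} (ht : t ∈ Icc 0 T) :
    HasDerivWithinAt P (-(M.riccatiOp γ (P t))) (Icc 0 T) t :=
  hasDerivWithinAt_of_apply fun i j => h.1 t ht i j

theorem SolvesRiccatiODE.exists_norm_le {γ T : ℝ} {P : ℝ → Matrix (Fin n) (Fin n) ℝ}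
    (h : M.SolvesRiccatiODE γ T P) : ∃ C : ℝ, ∀ t ∈ Icc 0 T, ‖P t‖ ≤ C :=
  isCompact_Icc.exists_bound_of_continuousOn fun _ ht => (h.hasDerivWithinAt ht).continuousWithinAt

/-- The difference of two solutions satisfies a linear equation whose coefficients are bounded on
the compact interval, so Gronwall backwards from `T` applies. -/
theorem SolvesRiccatiODE.unique {γ T : ℝ} {P₁ P₂ : ℝ → Matrix (Fin n) (Fin n) ℝ}
    (h₁ : M.SolvesRiccatiODE γ T P₁) (h₂ : M.SolvesRiccatiODE γ T P₂) :
    ∀ t ∈ Icc 0 T, P₁ t = P₂ t := by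
  obtain ⟨C₁, hC₁⟩ := h₁.exists_norm_le
  obtain ⟨C₂, hC₂⟩ := h₂.exists_norm_le
  have key := eqOn_zero_of_terminal (f := fun t => P₁ t - P₂ t)
    (f' := fun t => -(M.riccatiOp γ (P₁ t)) - -(M.riccatiOp γ (P₂ t)))
    (k := ‖(M.K1 γ)ᵀ‖ + ‖M.K1 γ‖ + C₁ * ‖M.quad γ‖ + ‖M.quad γ‖ * C₂)
    (fun t ht => (h₁.hasDerivWithinAt ht).sub (h₂.hasDerivWithinAt ht))
    (by simp only [h₁.2, h₂.2, sub_self]) fun t ht => ?_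
  · exact fun t ht => sub_eq_zero.mp (key t ht)
  have e : -(M.riccatiOp γ (P₁ t)) - -(M.riccatiOp γ (P₂ t)) =
      -((M.K1 γ)ᵀ * (P₁ t - P₂ t) + (P₁ t - P₂ t) * M.K1 γ + P₁ t * M.quad γ * (P₁ t - P₂ t) +
        (P₁ t - P₂ t) * (M.quad γ * P₂ t)) := by
    rw [riccatiOp_eq, riccatiOp_eq, riccati, riccati]
    noncomm_ring
  rw [e, norm_neg]
  have hp₁ := hC₁ t ht
  have hp₂ := hC₂ t ht
  generalize P₁ t - P₂ t = D
  calc ‖(M.K1 γ)ᵀ * D + D * M.K1 γ + P₁ t * M.quad γ * D + D * (M.quad γ * P₂ t)‖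
      ≤ ‖(M.K1 γ)ᵀ‖ * ‖D‖ + ‖D‖ * ‖M.K1 γ‖ + C₁ * ‖M.quad γ‖ * ‖D‖ + ‖D‖ * (‖M.quad γ‖ * C₂) := by
        refine norm_add_le_of_le (norm_add_le_of_le (norm_add_le_of_le (norm_mul_le _ _)
          (norm_mul_le _ _)) ?_) ?_
        · refine (norm_mul_le _ _).trans ?_
          gcongr
          refine (norm_mul_le _ _).trans ?_
          gcongr
        · refine (norm_mul_le _ _).trans ?_
          gcongr
          refine (norm_mul_le _ _).trans ?_
          gcongr
    _ = _ := by ring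

theorem SolvesLinearODE.unique {γ T : ℝ} {P₁ P₂ : ℝ → Matrix (Fin n) (Fin n) ℝ}
    {q₁ q₂ : ℝ → Fin n → ℝ} (hP₁ : M.SolvesRiccatiODE γ T P₁) (hP₂ : M.SolvesRiccatiODE γ T P₂)
    (h₁ : M.SolvesLinearODE γ T P₁ q₁) (h₂ : M.SolvesLinearODE γ T P₂ q₂) :
    ∀ t ∈ Icc 0 T, q₁ t = q₂ t := by
  have hc : ContinuousOn (fun t => (M.K1 γ + M.lam * M.NInv γ * M.lamᵀ * P₁ t)ᵀ) (Icc 0 T) := by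
    have h1 : Continuous fun X : Matrix (Fin n) (Fin n) ℝ =>
      (M.K1 γ + M.lam * M.NInv γ * M.lamᵀ * X)ᵀ := by fun_prop
    exact h1.comp_continuousOn fun t ht => (hP₁.hasDerivWithinAt ht).continuousWithinAt
  obtain ⟨C, hC⟩ := isCompact_Icc.exists_bound_of_continuousOn hc
  have key := eqOn_zero_of_terminal (f := fun t => q₁ t - q₂ t)
    (f' := fun t => -(M.linearOp γ (P₁ t) (q₁ t)) - -(M.linearOp γ (P₂ t) (q₂ t))) (k := C)
    (fun t ht => (h₁.1 t ht).sub (h₂.1 t ht))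
    (by simp only [h₁.2, h₂.2, sub_self]) fun t ht => ?_
  · exact fun t ht => sub_eq_zero.mp (key t ht)
  have e : -(M.linearOp γ (P₁ t) (q₁ t)) - -(M.linearOp γ (P₂ t) (q₂ t)) =
      -((M.K1 γ + M.lam * M.NInv γ * M.lamᵀ * P₁ t)ᵀ *ᵥ (q₁ t - q₂ t)) := by
    rw [← hP₁.unique hP₂ t ht, linearOp, linearOp, mulVec_sub]
    abel
  rw [e, norm_neg]
  refine (linfty_opNorm_mulVec _ _).trans ?_
  gcongr
  exact hC t ht

end Uniqueness

/-- The stationary equations are not used: the finite-horizon solutions are unique, so their limits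
at `t = 0` agree. -/
theorem IsStationaryData.unique {γ : ℝ} {X₁ X₂ : Matrix (Fin n) (Fin n) ℝ} {x₁ x₂ : Fin n → ℝ}
    (h₁ : M.IsStationaryData γ X₁ x₁) (h₂ : M.IsStationaryData γ X₂ x₂) : X₁ = X₂ ∧ x₁ = x₂ := by
  obtain ⟨P₁, q₁, hs₁, hl₁⟩ := h₁.limit
  obtain ⟨P₂, q₂, hs₂, hl₂⟩ := h₂.limit
  constructor
  · refine tendsto_nhds_unique (hl₁ 0 le_rfl).1 ((hl₂ 0 le_rfl).1.congr' ?_)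
    filter_upwards [eventually_gt_atTop 0] with T hT
    exact (hs₂ T hT).1.unique (hs₁ T hT).1 0 ⟨le_rfl, hT.le⟩
  · refine tendsto_nhds_unique (hl₁ 0 le_rfl).2 ((hl₂ 0 le_rfl).2.congr' ?_)
    filter_upwards [eventually_gt_atTop 0] with T hT
    exact (hs₂ T hT).2.unique (hs₂ T hT).1 (hs₁ T hT).1 (hs₁ T hT).2 0 ⟨le_rfl, hT.le⟩

section Existence

attribute [local instance] Matrix.linftyOpNormedAddCommGroup Matrix.linftyOpNormedSpace
  Matrix.linftyOpNormedRing Matrix.linftyOpNormedAlgebra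

theorem exists_isStationaryData (h1 : M.A1) (h2 : M.A2) {γ : ℝ} (hγ : γ < 0) :
    ∃ X x, M.IsStationaryData γ X x ∧ LyapunovStable (M.K1 γ + M.quad γ * X) := by
  have hG : LyapunovStable M.openLoop := IsStableMatrix.lyapunovStable h2
  have hR := h1.quad_posSemidef hγ
  have hW := M.cost_posSemidef γ
  have hτ := ratio_neg hγ
  have hτ1 := one_add_ratio_pos hγ
  obtain ⟨Q, hQs, hQ0, hQr, hQl⟩ := exists_tendsto_riccatiFlow hR hW hG
    (div_nonneg hτ1.le (by linarith)) (h1.stabilizable hγ)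
  obtain ⟨κ, hκ, hdet⟩ := h1.detectable hγ
  have hF := lyapunovStable_closedLoop hG hκ hdet hQs hQ0 hQr
  set F := M.K1 γ - M.quad γ * Q
  have hFX : M.K1 γ + M.quad γ * (-Q) = F := by rw [Matrix.mul_neg, ← sub_eq_add_neg]
  set x := (Fᵀ)⁻¹ *ᵥ (Q *ᵥ M.drift γ - M.forcing γ)
  have hx : Fᵀ *ᵥ x + M.forcing γ - Q *ᵥ M.drift γ = 0 := by
    rw [mulVec_mulVec, mul_nonsing_inv _ ((isUnit_iff_isUnit_det _).mp hF.transpose.isUnit),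
      one_mulVec]
    abel
  have hql := tendsto_affineFlow hR hW hQl hF hx
  -- The equations are autonomous, so the solution with horizon `T` is the forward flow evaluated at
  -- the remaining time `T - t`.
  refine ⟨-Q, x, ⟨hQs.neg, ?_, ?_, fun T t => -riccatiFlow (M.K1 γ) (M.quad γ) (M.cost γ) (T - t),
    fun T t => affineFlow (M.K1 γ) (M.quad γ) (M.cost γ) (M.drift γ) (M.forcing γ) (T - t),
    fun T hT => ⟨⟨?_, ?_⟩, ?_, ?_⟩, fun t ht => ⟨?_, ?_⟩⟩, ?_⟩
  · rw [riccatiOp_eq, neg_neg, hQr, neg_zero]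
  · rw [linearOp_eq, hFX, neg_mulVec, ← sub_eq_add_neg, hx]
  · intro t ht i j
    have h := hasDerivAt_riccatiFlow (K := M.K1 γ) hR hW (show 0 ≤ T - t by linarith [ht.2])
    have h3 := ((hasDerivAt_apply h i j).scomp t ((hasDerivAt_id t).const_sub T)).neg
    refine (h3.congr_deriv ?_).hasDerivWithinAt
    rw [riccatiOp_eq, neg_neg]
    simp
  · simp [riccatiFlow_zero]
  · intro t ht
    have h := hasDerivAt_affineFlow (K := M.K1 γ) hR hW (M.drift γ) (M.forcing γ)
      (show 0 ≤ T - t by linarith [ht.2])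
    have h3 := h.scomp t ((hasDerivAt_id t).const_sub T)
    refine (h3.congr_deriv ?_).hasDerivWithinAt
    rw [linearOp_eq, Matrix.mul_neg, ← sub_eq_add_neg, neg_mulVec, ← sub_eq_add_neg, neg_smul,
      one_smul]
  · simp [affineFlow_zero]
  · exact (hQl.comp (tendsto_atTop_add_const_right _ (-t) tendsto_id)).neg
  · exact hql.comp (tendsto_atTop_add_const_right _ (-t) tendsto_id)
  · rwa [hFX]

end Existence

/-- The closed loop of the stationary Riccati data is stable. -/
theorem IsStationaryData.lyapunovStable (h1 : M.A1) (h2 : M.A2) {γ : ℝ} (hγ : γ < 0)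
    {X : Matrix (Fin n) (Fin n) ℝ} {x : Fin n → ℝ} (h : M.IsStationaryData γ X x) :
    LyapunovStable (M.K1 γ + M.quad γ * X) := by
  obtain ⟨Y, y, hY, hs⟩ := exists_isStationaryData h1 h2 hγ
  rwa [(h.unique hY).1]

end FactorModel

/-! ### Smooth dependence on `γ`. -/

theorem twiceDifferentiableOnNeg_of_contDiffAt {E : Type*} [NormedAddCommGroup E]
    [NormedSpace ℝ E] {f : ℝ → E} (h : ∀ γ < 0, ContDiffAt ℝ 2 f γ) :
    TwiceDifferentiableOnNeg f := by
  have hon : ContDiffOn ℝ 2 f (Iio 0) := fun γ hγ => (h γ hγ).contDiffWithinAt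
  have hd : ContDiffOn ℝ 1 (deriv f) (Iio 0) := hon.deriv_of_isOpen isOpen_Iio (by norm_num)
  exact fun γ hγ => ⟨(h γ hγ).differentiableAt (by norm_num),
    (hd.contDiffAt (Iio_mem_nhds hγ)).differentiableAt (by norm_num)⟩

theorem LinearMap.comp_contDiffAt {E F G : Type*} [NormedAddCommGroup E] [NormedSpace ℝ E]
    [FiniteDimensional ℝ E] [NormedAddCommGroup F] [NormedSpace ℝ F] [NormedAddCommGroup G]
    [NormedSpace ℝ G] (L : E →ₗ[ℝ] F) {f : G → E} {x : G} {k : WithTop ℕ∞}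
    (hf : ContDiffAt ℝ k f x) : ContDiffAt ℝ k (fun s => L (f s)) x :=
  (L.toContinuousLinearMap.contDiff (n := k)).contDiffAt.comp x hf

namespace Matrix

attribute [local instance] Matrix.linftyOpNormedAddCommGroup Matrix.linftyOpNormedSpace
  Matrix.linftyOpNormedRing Matrix.linftyOpNormedAlgebra

variable {ι κ : Type*} [Fintype ι] [Fintype κ] {E : Type*}
  [NormedAddCommGroup E] [NormedSpace ℝ E] {k : WithTop ℕ∞} {x : E}

theorem contDiffAt_mul [DecidableEq ι] {f g : E → Matrix ι ι ℝ} (hf : ContDiffAt ℝ k f x)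
    (hg : ContDiffAt ℝ k g x) : ContDiffAt ℝ k (fun s => f s * g s) x :=
  hf.mul hg

theorem contDiffAt_transpose {f : E → Matrix κ ι ℝ} (hf : ContDiffAt ℝ k f x) :
    ContDiffAt ℝ k (fun s => (f s)ᵀ) x :=
  (transposeLinearEquiv κ ι ℝ ℝ).toLinearMap.comp_contDiffAt hf

theorem contDiffAt_apply {f : E → Matrix κ ι ℝ} (hf : ContDiffAt ℝ k f x) (i : κ) (j : ι) :
    ContDiffAt ℝ k (fun s => f s i j) x :=
  (entryLinearMap ℝ ℝ i j).comp_contDiffAt hf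

theorem contDiffAt_dotProduct {f g : E → ι → ℝ} (hf : ContDiffAt ℝ k f x)
    (hg : ContDiffAt ℝ k g x) : ContDiffAt ℝ k (fun s => f s ⬝ᵥ g s) x := by
  simp only [dotProduct]
  exact ContDiffAt.sum fun i _ => (contDiffAt_pi.mp hf i).mul (contDiffAt_pi.mp hg i)

theorem contDiffAt_mulVec {f : E → Matrix κ ι ℝ} {g : E → ι → ℝ} (hf : ContDiffAt ℝ k f x)
    (hg : ContDiffAt ℝ k g x) : ContDiffAt ℝ k (fun s => f s *ᵥ g s) x := by
  rw [contDiffAt_pi]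
  intro i
  simp only [mulVec, dotProduct]
  exact ContDiffAt.sum fun j _ => (contDiffAt_apply hf i j).mul (contDiffAt_pi.mp hg j)

theorem contDiffAt_inv [DecidableEq ι] {f : E → Matrix ι ι ℝ} (hf : ContDiffAt ℝ k f x)
    (h : IsUnit (f x)) : ContDiffAt ℝ k (fun s => (f s)⁻¹) x := by
  obtain ⟨u, hu⟩ := h
  have h1 := contDiffAt_ringInverse ℝ (n := k) u
  rw [hu] at h1
  rw [show (fun s => (f s)⁻¹) = fun s => Ring.inverse (f s) from
    funext fun s => nonsing_inv_eq_ringInverse (f s)]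
  exact h1.comp x hf

end Matrix

namespace FactorModel

open Matrix

attribute [local instance] Matrix.linftyOpNormedAddCommGroup Matrix.linftyOpNormedSpace
  Matrix.linftyOpNormedRing Matrix.linftyOpNormedAlgebra

variable {m n : ℕ} {M : FactorModel m n}

theorem contDiffAt_ratio {γ : ℝ} (hγ : γ < 0) {k : WithTop ℕ∞} :
    ContDiffAt ℝ k (fun γ : ℝ => γ / (1 - γ)) γ :=
  contDiffAt_id.div (contDiffAt_const.sub contDiffAt_id) (by simp; linarith)

theorem contDiffAt_K1 {γ : ℝ} (hγ : γ < 0) : ContDiffAt ℝ 2 M.K1 γ :=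
  contDiffAt_const.add ((contDiffAt_ratio hγ).smul contDiffAt_const)

theorem contDiffAt_quad {γ : ℝ} (hγ : γ < 0) : ContDiffAt ℝ 2 M.quad γ := by
  have h : M.quad = fun γ => M.lam * M.lamᵀ + (γ / (1 - γ)) • (M.lam * M.proj * M.lamᵀ) := by
    funext γ
    rw [quad, NInv, Matrix.mul_add, Matrix.mul_one, Matrix.add_mul, Matrix.mul_smul,
      Matrix.smul_mul, proj]
  rw [h]
  exact contDiffAt_const.add ((contDiffAt_ratio hγ).smul contDiffAt_const)

/-- The Riccati operator as a function of both arguments, with the constant term written as a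
smooth function of `γ`. -/
def jointRiccati (M : FactorModel m n) (z : ℝ × Matrix (Fin n) (Fin n) ℝ) :
    Matrix (Fin n) (Fin n) ℝ :=
  (M.K1 z.1)ᵀ * z.2 + z.2 * M.K1 z.1 + z.2 * M.quad z.1 * z.2 +
    (z.1 / (1 - z.1)) • (M.loadᵀ * M.load)

theorem jointRiccati_eq {γ : ℝ} (hγ : γ < 0) (X : Matrix (Fin n) (Fin n) ℝ) :
    M.jointRiccati (γ, X) = M.riccatiOp γ X := by
  rw [riccatiOp_eq, riccati, cost_eq hγ, jointRiccati]
  simp only [Matrix.mul_neg, Matrix.neg_mul, neg_neg, neg_smul]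
  abel

theorem contDiffAt_jointRiccati {γ : ℝ} (hγ : γ < 0) (X : Matrix (Fin n) (Fin n) ℝ) :
    ContDiffAt ℝ 2 M.jointRiccati (γ, X) := by
  have hfst : ContDiffAt ℝ 2 (Prod.fst : ℝ × Matrix (Fin n) (Fin n) ℝ → ℝ) (γ, X) := contDiffAt_fst
  have hX : ContDiffAt ℝ 2 (Prod.snd : ℝ × Matrix (Fin n) (Fin n) ℝ → _) (γ, X) := contDiffAt_snd
  have hK : ContDiffAt ℝ 2 (fun z : ℝ × Matrix (Fin n) (Fin n) ℝ => M.K1 z.1) (γ, X) :=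
    ContDiffAt.comp (g := M.K1) (γ, X) (contDiffAt_K1 hγ) hfst
  have hQ : ContDiffAt ℝ 2 (fun z : ℝ × Matrix (Fin n) (Fin n) ℝ => M.quad z.1) (γ, X) :=
    ContDiffAt.comp (g := M.quad) (γ, X) (contDiffAt_quad hγ) hfst
  have hr : ContDiffAt ℝ 2 (fun z : ℝ × Matrix (Fin n) (Fin n) ℝ => z.1 / (1 - z.1)) (γ, X) :=
    ContDiffAt.comp (g := (fun γ : ℝ => γ / (1 - γ))) (γ, X) (contDiffAt_ratio hγ) hfst
  exact (((contDiffAt_mul (contDiffAt_transpose hK) hX).add (contDiffAt_mul hX hK)).add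
    (contDiffAt_mul (contDiffAt_mul hX hQ) hX)).add (hr.smul contDiffAt_const)

theorem fderiv_jointRiccati {γ : ℝ} (hγ : γ < 0) {X : Matrix (Fin n) (Fin n) ℝ}
    (hX : X.IsSymm) (H : Matrix (Fin n) (Fin n) ℝ) :
    fderiv ℝ M.jointRiccati (γ, X) (0, H) =
      (M.K1 γ + M.quad γ * X)ᵀ * H + H * (M.K1 γ + M.quad γ * X) := by
  have hf := ((contDiffAt_jointRiccati (M := M) hγ X).differentiableAt (by norm_num)).hasFDerivAt
  have hl : HasDerivAt (fun t : ℝ => X + t • H) H 0 :=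
    (((hasDerivAt_id (0 : ℝ)).smul_const H).const_add X).congr_deriv (one_smul ℝ H)
  have hline : HasDerivAt (fun t : ℝ => ((γ, X + t • H) : ℝ × Matrix (Fin n) (Fin n) ℝ)) (0, H) 0 :=
    (hasDerivAt_const _ _).prodMk hl
  have hf' : HasFDerivAt M.jointRiccati (fderiv ℝ M.jointRiccati (γ, X))
      ((fun t : ℝ => ((γ, X + t • H) : ℝ × Matrix (Fin n) (Fin n) ℝ)) 0) := by
    rwa [show (fun t : ℝ => ((γ, X + t • H) : ℝ × Matrix (Fin n) (Fin n) ℝ)) 0 = (γ, X) by simp]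
  have hd1 := hf'.comp_hasDerivAt 0 hline
  have hd2 : HasDerivAt (fun t : ℝ => M.jointRiccati (γ, X + t • H))
      ((M.K1 γ)ᵀ * H + H * M.K1 γ + (H * M.quad γ * X + X * M.quad γ * H)) 0 := by
    have h := (((hl.const_mul (M.K1 γ)ᵀ).add (hl.mul_const (M.K1 γ))).add
      ((hl.mul_const (M.quad γ)).mul hl)).add_const ((γ / (1 - γ)) • (M.loadᵀ * M.load))
    refine h.congr_deriv ?_
    simp
  refine (hd1.unique hd2).trans ?_
  rw [transpose_add, transpose_mul, (quad_isSymm γ).eq, hX.eq]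
  noncomm_ring

/-- Subtracting two Riccati operators gives a Sylvester operator in the difference. The transpose on
`X` accommodates an `X` not known to be symmetric, such as the branch from the implicit function
theorem. -/
theorem riccatiOp_sub (γ : ℝ) (X Y : Matrix (Fin n) (Fin n) ℝ) :
    (M.K1 γ + M.quad γ * Xᵀ)ᵀ * (X - Y) + (X - Y) * (M.K1 γ + M.quad γ * Y) =
      M.riccatiOp γ X - M.riccatiOp γ Y := by
  rw [riccatiOp_eq, riccatiOp_eq, riccati, riccati, transpose_add, transpose_mul,
    (quad_isSymm γ).eq, transpose_transpose]
  noncomm_ring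

/-- The implicit branch `ψ` must be matched with `Pbar`, whose continuity is not yet known, so local
uniqueness of the branch is of no use. Instead `riccatiOp_sub` gives a Sylvester equation for `ψ -
Pbar`: one coefficient is stable near `γ₀` by openness and continuity of `ψ`, the other for every
negative `γ` because it is the closed loop of the data. -/
theorem contDiffAt_stationary (h1 : M.A1) (h2 : M.A2) {Pbar : ℝ → Matrix (Fin n) (Fin n) ℝ}
    {qbar : ℝ → Fin n → ℝ} (hs : ∀ γ < 0, M.IsStationaryData γ (Pbar γ) (qbar γ)) {γ₀ : ℝ}
    (hγ₀ : γ₀ < 0) : ContDiffAt ℝ 2 Pbar γ₀ := by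
  have hF := (hs γ₀ hγ₀).lyapunovStable h1 h2 hγ₀
  have hsym := (hs γ₀ hγ₀).symm
  have hc := contDiffAt_jointRiccati (M := M) hγ₀ (Pbar γ₀)
  set D := fderiv ℝ M.jointRiccati (γ₀, Pbar γ₀) ∘L
    ContinuousLinearMap.inr ℝ ℝ (Matrix (Fin n) (Fin n) ℝ)
  have hDapp : ∀ H, D H = (M.K1 γ₀ + M.quad γ₀ * Pbar γ₀)ᵀ * H +
      H * (M.K1 γ₀ + M.quad γ₀ * Pbar γ₀) := fun H => fderiv_jointRiccati hγ₀ hsym H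
  have hinj : Function.Injective D.toLinearMap := by
    rw [← LinearMap.ker_eq_bot, LinearMap.ker_eq_bot']
    intro H hH
    exact hF.eq_zero_of_sylvester hF ((hDapp H).symm.trans hH)
  have hinv : D.IsInvertible :=
    ⟨(LinearEquiv.ofInjectiveEndo D.toLinearMap hinj).toContinuousLinearEquiv, by
      ext H
      rfl⟩
  set ψ := hc.implicitFunction (by norm_num) hinv
  have hψ0 : ψ γ₀ = Pbar γ₀ := hc.implicitFunction_apply_self (by norm_num) hinv
  have hψc : ContDiffAt ℝ 2 ψ γ₀ := hc.contDiffAt_implicitFunction (by norm_num) hinv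
  have hψe : ∀ᶠ γ in 𝓝 γ₀, M.jointRiccati (γ, ψ γ) = M.jointRiccati (γ₀, Pbar γ₀) :=
    hc.eventually_apply_implicitFunction (by norm_num) hinv
  have hFc : ContinuousAt (fun γ => M.K1 γ + M.quad γ * (ψ γ)ᵀ) γ₀ :=
    ((contDiffAt_K1 hγ₀).add
      (contDiffAt_mul (contDiffAt_quad hγ₀) (contDiffAt_transpose hψc))).continuousAt
  have hFs : ∀ᶠ γ in 𝓝 γ₀, LyapunovStable (M.K1 γ + M.quad γ * (ψ γ)ᵀ) := by
    refine hFc.eventually ?_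
    change ∀ᶠ A in 𝓝 (M.K1 γ₀ + M.quad γ₀ * (ψ γ₀)ᵀ), LyapunovStable A
    rw [hψ0, hsym.eq]
    exact hF.eventually_stable
  refine hψc.congr_of_eventuallyEq ?_
  filter_upwards [hψe, hFs, Iio_mem_nhds hγ₀] with γ he hst hγ
  rw [jointRiccati_eq hγ, jointRiccati_eq hγ₀, (hs γ₀ hγ₀).riccati] at he
  have h := riccatiOp_sub (M := M) γ (ψ γ) (Pbar γ)
  rw [he, (hs γ hγ).riccati, sub_zero] at h
  exact (sub_eq_zero.mp
    (hst.eq_zero_of_sylvester ((hs γ hγ).lyapunovStable h1 h2 hγ) h)).symm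

theorem contDiffAt_stationary_linear (h1 : M.A1) (h2 : M.A2)
    {Pbar : ℝ → Matrix (Fin n) (Fin n) ℝ} {qbar : ℝ → Fin n → ℝ}
    (hs : ∀ γ < 0, M.IsStationaryData γ (Pbar γ) (qbar γ)) {γ₀ : ℝ} (hγ₀ : γ₀ < 0) :
    ContDiffAt ℝ 2 qbar γ₀ := by
  have hP := contDiffAt_stationary h1 h2 hs hγ₀
  have hF : ContDiffAt ℝ 2 (fun γ => (M.K1 γ + M.quad γ * Pbar γ)ᵀ) γ₀ :=
    contDiffAt_transpose ((contDiffAt_K1 hγ₀).add (contDiffAt_mul (contDiffAt_quad hγ₀) hP))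
  have hu : ∀ γ < 0, IsUnit (M.K1 γ + M.quad γ * Pbar γ)ᵀ := fun γ hγ =>
    ((hs γ hγ).lyapunovStable h1 h2 hγ).transpose.isUnit
  have hg : ContDiffAt ℝ 2 (fun γ => -(M.forcing γ + Pbar γ *ᵥ M.drift γ)) γ₀ :=
    (((contDiffAt_ratio hγ₀).smul contDiffAt_const).add (contDiffAt_mulVec hP
      (contDiffAt_const.add ((contDiffAt_ratio hγ₀).smul contDiffAt_const)))).neg
  refine (contDiffAt_mulVec (contDiffAt_inv hF (hu γ₀ hγ₀)) hg).congr_of_eventuallyEq ?_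
  filter_upwards [Iio_mem_nhds hγ₀] with γ hγ
  have hl := (hs γ hγ).linear
  rw [linearOp_eq, add_assoc] at hl
  rw [← eq_neg_of_add_eq_zero_left hl, mulVec_mulVec,
    nonsing_inv_mul _ ((isUnit_iff_isUnit_det _).mp (hu γ hγ)), one_mulVec]

theorem contDiffAt_ergodicConstant {Pbar : ℝ → Matrix (Fin n) (Fin n) ℝ} {qbar : ℝ → Fin n → ℝ}
    {γ₀ : ℝ} (hγ₀ : γ₀ < 0) (hP : ContDiffAt ℝ 2 Pbar γ₀) (hq : ContDiffAt ℝ 2 qbar γ₀) :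
    ContDiffAt ℝ 2 (fun γ => M.ergodicConstant γ (Pbar γ) (qbar γ)) γ₀ := by
  have htr : ContDiffAt ℝ 2 (fun γ => (M.lam * M.lamᵀ * Pbar γ).trace) γ₀ :=
    (traceLinearMap (Fin n) ℝ ℝ).comp_contDiffAt (contDiffAt_mul contDiffAt_const hP)
  have hx : ContDiffAt ℝ 2 (fun γ => M.excess + (M.vol * M.lamᵀ) *ᵥ qbar γ) γ₀ :=
    contDiffAt_const.add (contDiffAt_mulVec contDiffAt_const hq)
  have hr : ContDiffAt ℝ 2 (fun γ : ℝ => γ / (2 * (1 - γ))) γ₀ :=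
    contDiffAt_id.div (contDiffAt_const.mul (contDiffAt_const.sub contDiffAt_id))
      (by simp; linarith)
  exact ((((contDiffAt_const.mul htr).add (contDiffAt_const.mul (contDiffAt_dotProduct hq
    (contDiffAt_mulVec contDiffAt_const hq)))).add (contDiffAt_dotProduct contDiffAt_const hq)).add
    (contDiffAt_id.mul contDiffAt_const)).add
    (hr.mul (contDiffAt_dotProduct hx (contDiffAt_mulVec contDiffAt_const hx)))

theorem twiceDifferentiableOnNeg_stationary (h1 : M.A1) (h2 : M.A2)
    {Pbar : ℝ → Matrix (Fin n) (Fin n) ℝ} {qbar : ℝ → Fin n → ℝ} {χ : ℝ → ℝ}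
    (hs : ∀ γ < 0, M.IsStationaryData γ (Pbar γ) (qbar γ))
    (hχ : ∀ γ < 0, χ γ = M.ergodicConstant γ (Pbar γ) (qbar γ)) :
    TwiceDifferentiableOnNeg χ ∧ (∀ i j, TwiceDifferentiableOnNeg (fun γ => Pbar γ i j)) ∧
      TwiceDifferentiableOnNeg qbar := by
  have hP : ∀ γ < 0, ContDiffAt ℝ 2 Pbar γ := fun γ hγ => contDiffAt_stationary h1 h2 hs hγ
  have hq : ∀ γ < 0, ContDiffAt ℝ 2 qbar γ := fun γ hγ => contDiffAt_stationary_linear h1 h2 hs hγ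
  refine ⟨twiceDifferentiableOnNeg_of_contDiffAt fun γ hγ => ?_, fun i j =>
    twiceDifferentiableOnNeg_of_contDiffAt fun γ hγ => Matrix.contDiffAt_apply (hP γ hγ) i j,
    twiceDifferentiableOnNeg_of_contDiffAt hq⟩
  refine (contDiffAt_ergodicConstant (M := M) hγ (hP γ hγ) (hq γ hγ)).congr_of_eventuallyEq ?_
  filter_upwards [Iio_mem_nhds hγ] with s hs using hχ s hs

end FactorModel

/-! ### Convexity through the ergodic Bellman equation. -/

namespace FactorModel

open Matrix

variable {m n : ℕ} {M : FactorModel m n}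

/-- The excess return at the origin in noise coordinates, `Σ* (Σ Σ*)⁻¹ (a - r 𝟏)`. -/
def excessLoad (M : FactorModel m n) : Fin (n + m) → ℝ := (M.volᵀ * M.covInv) *ᵥ M.excess

/-- The excess return at the factor level `x` in noise coordinates. -/
def returnLoad (M : FactorModel m n) (x : Fin n → ℝ) : Fin (n + m) → ℝ :=
  M.load *ᵥ x + M.excessLoad

/-- The Hamiltonian of the ergodic Bellman equation. -/
def bellmanHam (M : FactorModel m n) (γ : ℝ) (y β : Fin (n + m) → ℝ) : ℝ :=
  1 / 2 * (y ⬝ᵥ y) + γ / (1 - γ) * (1 / 2 * ((M.proj *ᵥ y + β) ⬝ᵥ (M.proj *ᵥ y + β))) + γ * M.r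

theorem A1.proj_mulVec_load (h1 : M.A1) (x : Fin n → ℝ) :
    M.proj *ᵥ (M.load *ᵥ x) = M.load *ᵥ x := by
  rw [mulVec_mulVec, load, ← Matrix.mul_assoc, ← Matrix.mul_assoc, h1.proj_mul_vol]

theorem A1.proj_mulVec_excessLoad (h1 : M.A1) : M.proj *ᵥ M.excessLoad = M.excessLoad := by
  rw [excessLoad, mulVec_mulVec, ← Matrix.mul_assoc, h1.proj_mul_vol]

theorem A1.proj_mulVec_returnLoad (h1 : M.A1) (x : Fin n → ℝ) :
    M.proj *ᵥ M.returnLoad x = M.returnLoad x := by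
  rw [returnLoad, mulVec_add, h1.proj_mulVec_load, h1.proj_mulVec_excessLoad]

theorem dotProduct_proj_mulVec (y z : Fin (n + m) → ℝ) :
    (M.proj *ᵥ y) ⬝ᵥ z = y ⬝ᵥ (M.proj *ᵥ z) := by
  rw [mulVec_dotProduct_eq, proj_isSymm.eq]

theorem A1.dotProduct_covInv (h1 : M.A1) (z w : Fin m → ℝ) :
    ((M.volᵀ * M.covInv) *ᵥ z) ⬝ᵥ ((M.volᵀ * M.covInv) *ᵥ w) = z ⬝ᵥ (M.covInv *ᵥ w) := by
  rw [mulVec_dotProduct_eq, mulVec_mulVec, transpose_mul, covInv_isSymm.eq, transpose_transpose,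
    Matrix.mul_assoc, ← Matrix.mul_assoc M.vol, h1.mul_covInv, Matrix.mul_one]

/-- This is the Bellman equation at `x = 0`, where the gradient of the quadratic function is `q`. -/
theorem A1.ergodicConstant_eq (h1 : M.A1) (γ : ℝ) (X : Matrix (Fin n) (Fin n) ℝ)
    (q : Fin n → ℝ) :
    M.ergodicConstant γ X q = 1 / 2 * (M.lam * M.lamᵀ * X).trace + M.b ⬝ᵥ q +
      M.bellmanHam γ (M.lamᵀ *ᵥ q) M.excessLoad := by
  have e1 : q ⬝ᵥ ((M.lam * M.lamᵀ) *ᵥ q) = (M.lamᵀ *ᵥ q) ⬝ᵥ (M.lamᵀ *ᵥ q) := by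
    rw [← mulVec_mulVec, mulVec_dotProduct_eq, transpose_transpose]
  have e2 : M.proj *ᵥ (M.lamᵀ *ᵥ q) + M.excessLoad =
      (M.volᵀ * M.covInv) *ᵥ (M.excess + (M.vol * M.lamᵀ) *ᵥ q) := by
    rw [mulVec_add, excessLoad, add_comm (M.proj *ᵥ _), proj, mulVec_mulVec, mulVec_mulVec]
    simp only [Matrix.mul_assoc]
  rw [ergodicConstant, bellmanHam, e1, e2, h1.dotProduct_covInv]
  have e3 : γ / (2 * (1 - γ)) = γ / (1 - γ) * (1 / 2) := by
    rw [div_mul_div_comm, mul_one, mul_comm 2]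
  rw [e3]
  ring

/-- The stationary equations are the ergodic Bellman equation for a quadratic function. -/
theorem A1.bellman (h1 : M.A1) {γ : ℝ} (hγ : γ < 0) {X : Matrix (Fin n) (Fin n) ℝ}
    {q : Fin n → ℝ} (hX : X.IsSymm) (hr : M.riccatiOp γ X = 0) (hl : M.linearOp γ X q = 0)
    (x : Fin n → ℝ) :
    M.ergodicConstant γ X q = 1 / 2 * (M.lam * M.lamᵀ * X).trace +
      (M.B *ᵥ x + M.b) ⬝ᵥ (X *ᵥ x + q) +
      M.bellmanHam γ (M.lamᵀ *ᵥ (X *ᵥ x + q)) (M.returnLoad x) := by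
  have hK : M.K1 γ *ᵥ x = M.B *ᵥ x + (γ / (1 - γ)) • (M.lam *ᵥ (M.load *ᵥ x)) := by
    rw [K1, add_mulVec, smul_mulVec, load, mulVec_mulVec]
    simp only [Matrix.mul_assoc]
  have hlam : ∀ (z : Fin (n + m) → ℝ) (p : Fin n → ℝ), (M.lam *ᵥ z) ⬝ᵥ p = z ⬝ᵥ (M.lamᵀ *ᵥ p) :=
    fun z p => mulVec_dotProduct_eq _ _ _
  have hXs : ∀ p : Fin n → ℝ, x ⬝ᵥ (X *ᵥ p) = (X *ᵥ x) ⬝ᵥ p := fun p => by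
    rw [dotProduct_mulVec_eq, hX.eq]
  have hquad : ∀ p : Fin n → ℝ, (M.quad γ *ᵥ (X *ᵥ x)) ⬝ᵥ p =
      (M.lamᵀ *ᵥ (X *ᵥ x)) ⬝ᵥ (M.lamᵀ *ᵥ p) +
        γ / (1 - γ) * ((M.lamᵀ *ᵥ (X *ᵥ x)) ⬝ᵥ (M.proj *ᵥ (M.lamᵀ *ᵥ p))) := fun p => by
    rw [quad, ← mulVec_mulVec, ← mulVec_mulVec, hlam, NInv_mulVec, add_dotProduct,
      smul_dotProduct, dotProduct_proj_mulVec, smul_eq_mul]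
  -- The Bellman expression at `x` differs from its value at 0 by half the Riccati form plus the
  -- linear equation paired with `x`; both vanish.
  have hq2 : x ⬝ᵥ (M.riccatiOp γ X *ᵥ x) = 0 := by rw [hr, zero_mulVec, dotProduct_zero]
  rw [riccatiOp_eq, neg_mulVec, dotProduct_neg, dotProduct_riccati_mulVec hX.neg,
    dotProduct_cost hγ, neg_mulVec, mulVec_neg, neg_dotProduct, neg_dotProduct_neg, hK,
    dotProduct_comm (X *ᵥ x) (M.quad γ *ᵥ (X *ᵥ x)), hquad, dotProduct_add, dotProduct_smul,
    dotProduct_comm (X *ᵥ x) (M.lam *ᵥ (M.load *ᵥ x)), hlam, smul_eq_mul] at hq2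
  have hl2 : x ⬝ᵥ (M.linearOp γ X q) = 0 := by rw [hl, dotProduct_zero]
  have hforce : x ⬝ᵥ M.forcing γ = γ / (1 - γ) * ((M.load *ᵥ x) ⬝ᵥ M.excessLoad) := by
    rw [forcing, dotProduct_smul, smul_eq_mul, excessLoad, load, ← mulVec_mulVec _ _ M.A,
      h1.dotProduct_covInv, mulVec_dotProduct_eq, mulVec_mulVec]
  have hdrift : (X *ᵥ x) ⬝ᵥ M.drift γ = (X *ᵥ x) ⬝ᵥ M.b +
      γ / (1 - γ) * ((M.lamᵀ *ᵥ (X *ᵥ x)) ⬝ᵥ M.excessLoad) := by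
    rw [drift, dotProduct_add, dotProduct_smul, smul_eq_mul, Matrix.mul_assoc, ← mulVec_mulVec,
      dotProduct_comm (X *ᵥ x) (M.lam *ᵥ _), hlam, excessLoad, dotProduct_comm (M.lamᵀ *ᵥ _)]
  rw [linearOp_eq, dotProduct_add, dotProduct_add, ← mulVec_dotProduct_eq, add_mulVec,
    add_dotProduct, hK, add_dotProduct, smul_dotProduct, hlam, ← mulVec_mulVec, hquad, hforce, hXs,
    hdrift, smul_eq_mul] at hl2
  rw [h1.ergodicConstant_eq, bellmanHam, bellmanHam, returnLoad]
  have hd := h1.proj_mulVec_load x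
  have hu := h1.proj_mulVec_excessLoad
  have hs := dotProduct_proj_mulVec (M := M)
  have hi := h1.dotProduct_proj
  rw [mulVec_add M.lamᵀ, mulVec_add M.proj]
  generalize M.lamᵀ *ᵥ (X *ᵥ x) = yx at *
  generalize M.lamᵀ *ᵥ q = yq at *
  generalize M.load *ᵥ x = d at *
  generalize M.excessLoad = u at *
  generalize γ / (1 - γ) = τ at *
  have e1 : (M.proj *ᵥ yx) ⬝ᵥ d = d ⬝ᵥ yx := by rw [hs, hd, dotProduct_comm]
  have e2 : (M.proj *ᵥ yq) ⬝ᵥ d = d ⬝ᵥ yq := by rw [hs, hd, dotProduct_comm]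
  have e3 : (M.proj *ᵥ yx) ⬝ᵥ u = yx ⬝ᵥ u := by rw [hs, hu]
  have e4 : (M.proj *ᵥ yq) ⬝ᵥ u = yq ⬝ᵥ u := by rw [hs, hu]
  have e5 : (M.proj *ᵥ yq) ⬝ᵥ (M.proj *ᵥ yx) = yx ⬝ᵥ (M.proj *ᵥ yq) := by
    rw [dotProduct_comm, hs, mulVec_mulVec, h1.proj_mul_proj]
  simp only [add_dotProduct, dotProduct_add, hi, e1, e2, e3, e4, e5, dotProduct_comm d (M.proj *ᵥ yx),
    dotProduct_comm d (M.proj *ᵥ yq), dotProduct_comm u (M.proj *ᵥ yx),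
    dotProduct_comm u (M.proj *ᵥ yq), dotProduct_comm (M.proj *ᵥ yx) (M.proj *ᵥ yq),
    dotProduct_comm u d, dotProduct_comm yq yx, dotProduct_comm M.b (X *ᵥ x)]
  rw [dotProduct_comm (X *ᵥ x) (M.B *ᵥ x)] at hq2
  linear_combination (-1 / 2) * hq2 - hl2

/-- Joint convexity of the Bellman Hamiltonian in `(γ, y)`, as a gradient inequality. -/
theorem A1.bellmanHam_gradient (h1 : M.A1) {γ₀ γ₁ : ℝ} (h₀ : γ₀ < 0) (h₁ : γ₁ < 0)
    (y₀ y₁ β : Fin (n + m) → ℝ) (hβ : M.proj *ᵥ β = β) :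
    (y₀ + (γ₀ / (1 - γ₀)) • (M.proj *ᵥ y₀ + β)) ⬝ᵥ (y₁ - y₀) +
      (M.r + 1 / 2 * ((M.proj *ᵥ y₀ + β) ⬝ᵥ (M.proj *ᵥ y₀ + β)) / (1 - γ₀) ^ 2) * (γ₁ - γ₀) ≤
      M.bellmanHam γ₁ y₁ β - M.bellmanHam γ₀ y₀ β := by
  set u₀ := M.proj *ᵥ y₀ + β with hu₀
  set u₁ := M.proj *ᵥ y₁ + β with hu₁
  have hd₀ : 0 < 1 - γ₀ := by linarith
  have hd₁ : 0 < 1 - γ₁ := by linarith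
  have hdiff : u₁ - u₀ = M.proj *ᵥ (y₁ - y₀) := by
    rw [hu₀, hu₁, mulVec_sub]
    abel
  have hfix : M.proj *ᵥ u₀ = u₀ := by
    rw [hu₀, mulVec_add, hβ, mulVec_mulVec, h1.proj_mul_proj]
  have e1 : u₀ ⬝ᵥ (y₁ - y₀) = u₀ ⬝ᵥ u₁ - u₀ ⬝ᵥ u₀ := by
    rw [← dotProduct_sub, hdiff, ← dotProduct_proj_mulVec, hfix]
  -- Since `τ = -1 + 1 / (1 - γ)`, the Hamiltonian contains `½ |y|² - ½ |u|²`, convex in `y` because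
  -- the projection is a contraction.
  have e2 : u₁ ⬝ᵥ u₁ - 2 * (u₀ ⬝ᵥ u₁) + u₀ ⬝ᵥ u₀ ≤ y₁ ⬝ᵥ y₁ - 2 * (y₀ ⬝ᵥ y₁) + y₀ ⬝ᵥ y₀ := by
    have h := h1.proj_le (y₁ - y₀)
    rw [← h1.dotProduct_proj, ← hdiff] at h
    simp only [sub_dotProduct, dotProduct_sub, dotProduct_comm u₁ u₀, dotProduct_comm y₁ y₀] at h
    linarith
  -- The remaining part `|u|² / (1 - γ)` is a perspective function; this square is its joint
  -- convexity gap, up to the factor `1 / (1 - γ₁)`.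
  have e3 := dotProduct_self_nonneg (u₁ - ((1 - γ₁) / (1 - γ₀)) • u₀)
  simp only [sub_dotProduct, dotProduct_sub, smul_dotProduct, dotProduct_smul, smul_eq_mul,
    dotProduct_comm u₁ u₀] at e3
  have e4 := mul_nonneg (one_div_pos.mpr hd₁).le e3
  rw [bellmanHam, bellmanHam, ← hu₀, ← hu₁, add_dotProduct, smul_dotProduct, e1, dotProduct_sub,
    smul_eq_mul]
  generalize u₀ ⬝ᵥ u₀ = a at *
  generalize u₀ ⬝ᵥ u₁ = b at *
  generalize u₁ ⬝ᵥ u₁ = c at *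
  have e5 : 1 / (1 - γ₁) * (c - (1 - γ₁) / (1 - γ₀) * b -
      ((1 - γ₁) / (1 - γ₀) * (b - (1 - γ₁) / (1 - γ₀) * a))) =
      (c - 2 * b + a) + γ₁ / (1 - γ₁) * c - γ₀ / (1 - γ₀) * a - 2 * (γ₀ / (1 - γ₀) * (b - a)) -
        a / (1 - γ₀) ^ 2 * (γ₁ - γ₀) := by
    field_simp
    ring
  rw [e5] at e4
  have e6 : 1 / 2 * (y₁ ⬝ᵥ y₁) + γ₁ / (1 - γ₁) * (1 / 2 * c) + γ₁ * M.r -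
      (1 / 2 * (y₀ ⬝ᵥ y₀) + γ₀ / (1 - γ₀) * (1 / 2 * a) + γ₀ * M.r) -
      (y₀ ⬝ᵥ y₁ - y₀ ⬝ᵥ y₀ + γ₀ / (1 - γ₀) * (b - a) +
        (M.r + 1 / 2 * a / (1 - γ₀) ^ 2) * (γ₁ - γ₀)) =
      1 / 2 * ((c - 2 * b + a) + γ₁ / (1 - γ₁) * c - γ₀ / (1 - γ₀) * a -
        2 * (γ₀ / (1 - γ₀) * (b - a)) - a / (1 - γ₀) ^ 2 * (γ₁ - γ₀)) +
      1 / 2 * (y₁ ⬝ᵥ y₁ - 2 * (y₀ ⬝ᵥ y₁) + y₀ ⬝ᵥ y₀ - (c - 2 * b + a)) := by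
    ring
  linarith

/-- The supporting affine inequality for the ergodic constant behind its convexity. -/
theorem A1.ergodicConstant_sub_ge (h1 : M.A1) {γ₀ γ₁ : ℝ} (h₀ : γ₀ < 0) (h₁ : γ₁ < 0)
    {X₀ X₁ : Matrix (Fin n) (Fin n) ℝ} {q₀ q₁ : Fin n → ℝ} (hs₀ : M.IsStationaryData γ₀ X₀ q₀)
    (hs₁ : M.IsStationaryData γ₁ X₁ q₁) (x : Fin n → ℝ) :
    1 / 2 * (M.lam * M.lamᵀ * (X₁ - X₀)).trace +
      ((M.K1 γ₀ + M.quad γ₀ * X₀) *ᵥ x + (M.drift γ₀ + M.quad γ₀ *ᵥ q₀)) ⬝ᵥ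
        ((X₁ - X₀) *ᵥ x + (q₁ - q₀)) +
      (M.r + 1 / 2 * ((M.proj *ᵥ (M.lamᵀ *ᵥ (X₀ *ᵥ x + q₀)) + M.returnLoad x) ⬝ᵥ
        (M.proj *ᵥ (M.lamᵀ *ᵥ (X₀ *ᵥ x + q₀)) + M.returnLoad x)) / (1 - γ₀) ^ 2) * (γ₁ - γ₀) ≤
      M.ergodicConstant γ₁ X₁ q₁ - M.ergodicConstant γ₀ X₀ q₀ := by
  have hb₀ := h1.bellman h₀ hs₀.symm hs₀.riccati hs₀.linear x
  have hb₁ := h1.bellman h₁ hs₁.symm hs₁.riccati hs₁.linear x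
  have hg := h1.bellmanHam_gradient h₀ h₁ (M.lamᵀ *ᵥ (X₀ *ᵥ x + q₀)) (M.lamᵀ *ᵥ (X₁ *ᵥ x + q₁))
    (M.returnLoad x) (h1.proj_mulVec_returnLoad x)
  have htr : (M.lam * M.lamᵀ * (X₁ - X₀)).trace =
      (M.lam * M.lamᵀ * X₁).trace - (M.lam * M.lamᵀ * X₀).trace := by
    rw [Matrix.mul_sub, trace_sub]
  have hdiff : (X₁ - X₀) *ᵥ x + (q₁ - q₀) = (X₁ *ᵥ x + q₁) - (X₀ *ᵥ x + q₀) := by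
    rw [sub_mulVec]
    abel
  have hdrift : (M.K1 γ₀ + M.quad γ₀ * X₀) *ᵥ x + (M.drift γ₀ + M.quad γ₀ *ᵥ q₀) =
      (M.B *ᵥ x + M.b) + M.lam *ᵥ (M.lamᵀ *ᵥ (X₀ *ᵥ x + q₀) +
        (γ₀ / (1 - γ₀)) • (M.proj *ᵥ (M.lamᵀ *ᵥ (X₀ *ᵥ x + q₀)) + M.returnLoad x)) := by
    have hK : M.K1 γ₀ *ᵥ x = M.B *ᵥ x + (γ₀ / (1 - γ₀)) • (M.lam *ᵥ (M.load *ᵥ x)) := by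
      rw [K1, add_mulVec, smul_mulVec, load, mulVec_mulVec]
      simp only [Matrix.mul_assoc]
    have hQ : ∀ p, M.quad γ₀ *ᵥ p = M.lam *ᵥ (M.lamᵀ *ᵥ p +
        (γ₀ / (1 - γ₀)) • (M.proj *ᵥ (M.lamᵀ *ᵥ p))) := fun p => by
      rw [quad, ← mulVec_mulVec, ← mulVec_mulVec, NInv_mulVec]
    have hD : M.drift γ₀ = M.b + (γ₀ / (1 - γ₀)) • (M.lam *ᵥ M.excessLoad) := by
      rw [drift, excessLoad, mulVec_mulVec, Matrix.mul_assoc]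
    rw [add_mulVec, ← mulVec_mulVec, hK, hD]
    have e : M.B *ᵥ x + (γ₀ / (1 - γ₀)) • (M.lam *ᵥ (M.load *ᵥ x)) + M.quad γ₀ *ᵥ (X₀ *ᵥ x) +
        (M.b + (γ₀ / (1 - γ₀)) • (M.lam *ᵥ M.excessLoad) + M.quad γ₀ *ᵥ q₀) =
        (M.B *ᵥ x + M.b) + (M.quad γ₀ *ᵥ (X₀ *ᵥ x + q₀) +
          (γ₀ / (1 - γ₀)) • (M.lam *ᵥ M.returnLoad x)) := by
      rw [returnLoad, mulVec_add, mulVec_add, smul_add]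
      abel
    rw [e, hQ, ← mulVec_smul M.lam, ← mulVec_add, smul_add, add_assoc (M.lamᵀ *ᵥ _)]
  rw [hb₀, hb₁, htr, hdiff, hdrift, add_dotProduct, mulVec_dotProduct_eq M.lam, mulVec_sub M.lamᵀ,
    dotProduct_sub (M.B *ᵥ x + M.b)]
  linarith

/-- If the generator of a stable affine flow applied to a quadratic function is bounded above by
`k`, then its diffusion part is at most `k`. -/
theorem _root_.Matrix.LyapunovStable.trace_nonneg_of_le {F V : Matrix (Fin n) (Fin n) ℝ}
    (hF : LyapunovStable F) (hV : V.IsSymm) {f v : Fin n → ℝ} {k : ℝ}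
    (h : ∀ x, (F *ᵥ x + f) ⬝ᵥ (V *ᵥ x + v) ≤ k) (L : Matrix (Fin n) (Fin (n + m)) ℝ) :
    0 ≤ k ∧ 0 ≤ (L * Lᵀ * V).trace := by
  -- At the equilibrium of the affine drift the left side vanishes, which gives `0 ≤ k`.
  set x₀ := -(F⁻¹ *ᵥ f) with hx₀
  have hFx₀ : F *ᵥ x₀ + f = 0 := by
    rw [hx₀, mulVec_neg, mulVec_mulVec, mul_nonsing_inv _
      ((isUnit_iff_isUnit_det _).mp hF.isUnit), one_mulVec, neg_add_cancel]
  have hk : 0 ≤ k := by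
    have := h x₀
    rwa [hFx₀, zero_dotProduct] at this
  have hquad : ∀ ξ, (F *ᵥ ξ) ⬝ᵥ (V *ᵥ ξ) ≤ 0 := by
    intro ξ
    by_contra hpos
    push Not at hpos
    have hline : ∀ t : ℝ, t * (t * ((F *ᵥ ξ) ⬝ᵥ (V *ᵥ ξ))) + t * ((F *ᵥ ξ) ⬝ᵥ (V *ᵥ x₀ + v)) ≤ k := by
      intro t
      have ht := h (x₀ + t • ξ)
      have e1 : F *ᵥ (x₀ + t • ξ) + f = t • (F *ᵥ ξ) := by
        rw [mulVec_add, mulVec_smul, add_right_comm, hFx₀, zero_add]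
      have e2 : V *ᵥ (x₀ + t • ξ) + v = t • (V *ᵥ ξ) + (V *ᵥ x₀ + v) := by
        rw [mulVec_add, mulVec_smul]
        abel
      rw [e1, e2, smul_dotProduct, dotProduct_add, dotProduct_smul, smul_eq_mul, smul_eq_mul,
        mul_add] at ht
      exact ht
    generalize (F *ᵥ ξ) ⬝ᵥ (V *ᵥ ξ) = a at *
    have hs : Real.sqrt ((k + 1) / a) * Real.sqrt ((k + 1) / a) = (k + 1) / a :=
      Real.mul_self_sqrt (by positivity)
    -- Adding the bounds at `t` and `-t` removes the linear term; with `t² a = k + 1` this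
    -- contradicts the bound `k`.
    have e1 := hline (Real.sqrt ((k + 1) / a))
    have e2 := hline (-Real.sqrt ((k + 1) / a))
    have e3 : (k + 1) / a * a = k + 1 := div_mul_cancel₀ _ hpos.ne'
    rw [← hs] at e3
    linarith
  -- The quadratic part being nonpositive is the Lyapunov inequality for `V`, and stability of `F`
  -- turns it into `V ≥ 0`.
  have hVnn : ∀ x, 0 ≤ x ⬝ᵥ (V *ᵥ x) := by
    refine hF.dotProduct_mulVec_nonneg fun x => ?_
    have h1 : x ⬝ᵥ ((Fᵀ * V + V * F) *ᵥ x) = 2 * ((F *ᵥ x) ⬝ᵥ (V *ᵥ x)) := by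
      rw [add_mulVec, dotProduct_add, ← mulVec_mulVec, ← mulVec_mulVec, ← mulVec_dotProduct_eq,
        dotProduct_mulVec_comm hV x]
      ring
    linarith [hquad x]
  have hVp : V.PosSemidef := PosSemidef.of_dotProduct_mulVec_nonneg
    (by rw [IsHermitian, conjTranspose_eq_transpose_of_trivial]; exact hV)
    fun x => by rw [star_trivial]; exact hVnn x
  refine ⟨hk, ?_⟩
  have h2 := (hVp.conjTranspose_mul_mul_same L).trace_nonneg
  rwa [conjTranspose_eq_transpose_of_trivial, Matrix.mul_assoc, trace_mul_comm, Matrix.mul_assoc,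
    trace_mul_comm] at h2

theorem convexOn_ergodicConstant (h1 : M.A1) (h2 : M.A2) {Pbar : ℝ → Matrix (Fin n) (Fin n) ℝ}
    {qbar : ℝ → Fin n → ℝ} (hs : ∀ γ < 0, M.IsStationaryData γ (Pbar γ) (qbar γ)) :
    ConvexOn ℝ (Iio 0) (fun γ => M.ergodicConstant γ (Pbar γ) (qbar γ)) := by
  refine ⟨convex_Iio 0, fun γ₁ h₁ γ₂ h₂ s₁ s₂ hs₁ hs₂ hsum => ?_⟩
  have h₀ : s₁ • γ₁ + s₂ • γ₂ < 0 := (convex_Iio (0 : ℝ)) h₁ h₂ hs₁ hs₂ hsum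
  have hγ : s₁ * (γ₁ - (s₁ • γ₁ + s₂ • γ₂)) + s₂ * (γ₂ - (s₁ • γ₁ + s₂ • γ₂)) = 0 := by
    simp only [smul_eq_mul]
    linear_combination (-(s₁ * γ₁) - s₂ * γ₂) * hsum
  simp only [smul_eq_mul (α := ℝ)]
  simp only [smul_eq_mul (α := ℝ)] at h₀ hγ
  set γ₀ := s₁ * γ₁ + s₂ * γ₂
  have hst₀ := hs γ₀ h₀
  have hF := hst₀.lyapunovStable h1 h2 h₀
  have hge₁ := h1.ergodicConstant_sub_ge h₀ h₁ hst₀ (hs γ₁ h₁)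
  have hge₂ := h1.ergodicConstant_sub_ge h₀ h₂ hst₀ (hs γ₂ h₂)
  set χ₀ := M.ergodicConstant γ₀ (Pbar γ₀) (qbar γ₀)
  set χ₁ := M.ergodicConstant γ₁ (Pbar γ₁) (qbar γ₁)
  set χ₂ := M.ergodicConstant γ₂ (Pbar γ₂) (qbar γ₂)
  set V := s₁ • (Pbar γ₁ - Pbar γ₀) + s₂ • (Pbar γ₂ - Pbar γ₀) with hV
  set v := s₁ • (qbar γ₁ - qbar γ₀) + s₂ • (qbar γ₂ - qbar γ₀) with hv
  have hVs : V.IsSymm :=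
    (((hs γ₁ h₁).symm.sub hst₀.symm).smul s₁).add (((hs γ₂ h₂).symm.sub hst₀.symm).smul s₂)
  have htr : (M.lam * M.lamᵀ * V).trace = s₁ * (M.lam * M.lamᵀ * (Pbar γ₁ - Pbar γ₀)).trace +
      s₂ * (M.lam * M.lamᵀ * (Pbar γ₂ - Pbar γ₀)).trace := by
    rw [hV, Matrix.mul_add, trace_add, Matrix.mul_smul, Matrix.mul_smul, trace_smul, trace_smul,
      smul_eq_mul, smul_eq_mul]
  -- The bound `k` is the convexity gap minus the diffusion term; `k ≥ 0` and a nonnegative trace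
  -- together make the gap nonnegative.
  have key := hF.trace_nonneg_of_le (f := M.drift γ₀ + M.quad γ₀ *ᵥ qbar γ₀) (v := v) hVs
    (k := s₁ * (χ₁ - χ₀) + s₂ * (χ₂ - χ₀) - 1 / 2 * (M.lam * M.lamᵀ * V).trace) (fun x => ?_) M.lam
  · have e : s₁ * (χ₁ - χ₀) + s₂ * (χ₂ - χ₀) = s₁ * χ₁ + s₂ * χ₂ - χ₀ := by
      linear_combination (-χ₀) * hsum
    linarith [key.1, key.2]
  · have e₁ := mul_le_mul_of_nonneg_left (hge₁ x) hs₁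
    have e₂ := mul_le_mul_of_nonneg_left (hge₂ x) hs₂
    have hVx : V *ᵥ x + v = s₁ • ((Pbar γ₁ - Pbar γ₀) *ᵥ x + (qbar γ₁ - qbar γ₀)) +
        s₂ • ((Pbar γ₂ - Pbar γ₀) *ᵥ x + (qbar γ₂ - qbar γ₀)) := by
      rw [hV, hv, add_mulVec, smul_mulVec, smul_mulVec, smul_add, smul_add]
      abel
    rw [hVx, dotProduct_add, dotProduct_smul, dotProduct_smul, htr, smul_eq_mul, smul_eq_mul]
    -- The `γ`-slope depends only on `γ₀` and `x`, so it is common to both inequalities and cancels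
    -- in the average by `hγ`.
    generalize (M.r + 1 / 2 * ((M.proj *ᵥ (M.lamᵀ *ᵥ (Pbar γ₀ *ᵥ x + qbar γ₀)) + M.returnLoad x) ⬝ᵥ
        (M.proj *ᵥ (M.lamᵀ *ᵥ (Pbar γ₀ *ᵥ x + qbar γ₀)) + M.returnLoad x)) / (1 - γ₀) ^ 2) = η at *
    have e₃ : s₁ * (η * (γ₁ - γ₀)) + s₂ * (η * (γ₂ - γ₀)) = 0 := by
      linear_combination η * hγ
    linarith

end FactorModel

end

theorem proposition2p5 {m n : ℕ} (M : FactorModel m n) (h1 : M.A1) (h2 : M.A2) :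
    (∀ γ : ℝ, γ < 0 → ∃! d : Matrix (Fin n) (Fin n) ℝ × (Fin n → ℝ),
      M.IsStationaryData γ d.1 d.2) ∧
    ∀ (Pbar : ℝ → Matrix (Fin n) (Fin n) ℝ) (qbar : ℝ → Fin n → ℝ) (χ : ℝ → ℝ),
      (∀ γ : ℝ, γ < 0 → M.IsStationaryData γ (Pbar γ) (qbar γ) ∧
        χ γ = M.ergodicConstant γ (Pbar γ) (qbar γ)) →
      TwiceDifferentiableOnNeg χ ∧
      (∀ i j, TwiceDifferentiableOnNeg (fun γ => Pbar γ i j)) ∧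
      TwiceDifferentiableOnNeg qbar ∧
      ConvexOn ℝ (Set.Iio 0) χ := by
  refine ⟨fun γ hγ => ?_, fun Pbar qbar χ h => ?_⟩
  · obtain ⟨X, x, hXx, -⟩ := FactorModel.exists_isStationaryData h1 h2 hγ
    refine ⟨(X, x), hXx, fun d hd => ?_⟩
    obtain ⟨hX, hx⟩ := hd.unique hXx
    exact Prod.ext hX hx
  · have hs : ∀ γ < 0, M.IsStationaryData γ (Pbar γ) (qbar γ) := fun γ hγ => (h γ hγ).1
    obtain ⟨hχ, hP, hq⟩ := FactorModel.twiceDifferentiableOnNeg_stationary h1 h2 hs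
      fun γ hγ => (h γ hγ).2
    exact ⟨hχ, hP, hq,
      (FactorModel.convexOn_ergodicConstant h1 h2 hs).congr fun γ hγ => ((h γ hγ).2).symm⟩
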